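/- Let $L\ge 2$ be an integer. An input consists of a set $M$ of items, a finite set $N$ of products, a bundle $A_j\subseteq M$ with $1\le |A_j|\le L$ for every $j\in N$, a partition $N=N_1\cup\dots\cup N_T$ into batches, and numbers $x_j\ge 0$ $(j\in N)$ with $\sum_{j:\,i\in A_j}x_j\le 1$ for every $i\in M$ and $\sum_{j\in N_t}x_j\le 1$ for every $t$. The batches arrive in uniformly random order. When $N_t$ arrives, at most one product of $N_t$ becomes active, independently of everything before: $j\in N_t$ is active with probability $x_j$, and no product of $N_t$ is active with probability $1-\sum_{j\in N_t}x_j$. A random-element random-order contention resolution scheme (RCRS) must decide at once, possibly using randomness, whether to accept the active product $j$; it may do so only if $j$ is feasible, i.e. $A_j\cap A_{j'}=\emptyset$ for every previously accepted $j'$. The scheme is $\alpha$-selectable if, for every input and every $j\in N$, it accepts $j$ with probability at least $\alpha x_j$. For $j\in N_t$ let $x_{t,j}:=\sum_{j'\in N_t:\,A_{j'}\cap A_j\ne\emptyset}x_{j'}$, and for $x\in[0,1]$ let $$b(x):=\frac{(L-x)(1-e^{-L})}{L(1-e^{-(L-x)})}\in[0,1].$$ The attenuate-greedy RCRS draws,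 whenever a product $j\in N_t$ is active, an independent bit $B_j\sim\mathrm{Ber}(b(x_{t,j}))$, and accepts $j$ if and only if $j$ is feasible and $B_j=1$. **Theorem.** Let $$\alpha:=\frac{3-6e^{1/2}+e+8e^{3/2}+21e^2+14e^{5/2}+7e^3}{16e(1+e^{1/2}+e)^2}\quad\text{if }L=2,$$ $$\alpha:=\frac{(e^L-e^{1/L})\left(1-\left(1+\frac{(e^L-1)(L^2-1)}{(e^{1/L}-e^L)L^2}\right)^L\right)}{(e^L-e)(1+L)}\quad\text{if }L\ge 3.$$ Then $\alpha>\frac1{1+L}$, with $0.397\le\alpha<0.398$ if $L=2$, and the attenuate-greedy RCRS is $\alpha$-selectable. -/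

import Mathlib

universe u v

noncomputable section

namespace RandomElement

open scoped ENNReal

/-- An input with `L`-bounded products: items `M`, finitely many products `N`, product `j`
requires the nonempty bundle `bundle j` of at most `L` items, the products are partitioned into
the `T` batches `{j | batch j = t}` (possibly empty), and `x` is a fractional solution that satisfies
the item constraints in expectation and has total mass at most one on every batch. -/
structure Input (M : Type u) (N : Type v) [Fintype N] (T L : ℕ) where
  batch : N → Fin T
  bundle : N → Finset M
  x : N → ℝ
  bundle_nonempty : ∀ j, (bundle j).Nonempty
  bundle_card_le : ∀ j, (bundle j).card ≤ L
  x_nonneg : ∀ j, 0 ≤ x j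
  item_le_one : ∀ i : M, (open Classical in ∑ j with i ∈ bundle j, x j) ≤ 1
  batch_le_one : ∀ t, ∑ j with batch j = t, x j ≤ 1

/-- What an online algorithm has seen of one batch: its index, its active product (if any), and
whether that product was accepted. -/
structure Round (N : Type v) (T : ℕ) where
  batch : Fin T
  active : Option N
  accepted : Bool

/-- The past of a run, most recent batch first. -/
abbrev History (N : Type v) (T : ℕ) : Type v := List (Round N T)

/-- The products accepted in a history. -/
def accepted {N : Type v} {T : ℕ} (h : History N T) : Set N :=
  {j | ∃ r ∈ h, r.active = some j ∧ r.accepted = true}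

/-- A (randomized) online selection rule for one input: given the past and the product that is
active in the arriving batch, the conditional probability of accepting that product, should it be
feasible. -/
abbrev Policy (N : Type v) (T : ℕ) : Type v := History N T → N → unitInterval

namespace Input

variable {M : Type u} {N : Type v} [Fintype N] {T L : ℕ} (I : Input M N T L)

/-- A product is feasible if its bundle meets no bundle of a previously accepted product. -/
def Feasible (h : History N T) (j : N) : Prop :=
  ∀ j' ∈ accepted h, Disjoint (I.bundle j) (I.bundle j')

/-- The probability that a given outcome (a product or no product) is the active one of batch
`t`. -/
def activeProb (t : Fin T) : Option N → ℝ
  | none => 1 - ∑ j with I.batch j = t, I.x j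
  | some j => if I.batch j = t then I.x j else 0

theorem activeProb_nonneg (t : Fin T) (o : Option N) : 0 ≤ I.activeProb t o := by
  cases o with
  | none => simpa [activeProb] using I.batch_le_one t
  | some j =>
    simp only [activeProb]
    split_ifs
    · exact I.x_nonneg j
    · exact le_rfl

theorem sum_activeProb (t : Fin T) : ∑ o, I.activeProb t o = 1 := by
  rw [Fintype.sum_option]
  simp [activeProb, Finset.sum_filter]

/-- The law of the active product of batch `t`. -/
def activeLaw (t : Fin T) : PMF (Option N) :=
  PMF.ofFintype (fun o => ENNReal.ofReal (I.activeProb t o)) (by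
    rw [← ENNReal.ofReal_sum_of_nonneg fun o _ => I.activeProb_nonneg t o, I.sum_activeProb t,
      ENNReal.ofReal_one])

end Input

/-- A biased coin. -/
def coin (p : unitInterval) : PMF Bool :=
  PMF.ofFintype (fun d => ENNReal.ofReal (if d then (p : ℝ) else 1 - p)) (by
    rw [Fintype.sum_bool, ← ENNReal.ofReal_add] <;> simp [p.2.1, p.2.2])

namespace Input

variable {M : Type u} {N : Type v} [Fintype N] {T L : ℕ} (I : Input M N T L)

open Classical in
/-- Arrival of batch `t`: its active product is drawn independently of the past, and if that
product exists and is feasible, it is accepted with the probability that the policy prescribes;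
otherwise nothing is accepted. -/
def step (π : Policy N T) (h : History N T) (t : Fin T) : PMF (History N T) :=
  (I.activeLaw t).bind fun
    | none => PMF.pure (⟨t, none, false⟩ :: h)
    | some j =>
      if I.Feasible h j then (coin (π h j)).map fun d => ⟨t, some j, d⟩ :: h
      else PMF.pure (⟨t, some j, false⟩ :: h)

/-- The law of the history after the batches in the list `order` have arrived, in that order. -/
def run (π : Policy N T) (order : List (Fin T)) : PMF (History N T) :=
  order.foldl (fun μ t => μ.bind fun h => I.step π h t) (PMF.pure [])

/-- The law of the final history when all the batches arrive in uniformly random order. -/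
def law (π : Policy N T) : PMF (History N T) :=
  (PMF.uniformOfFintype (Equiv.Perm (Fin T))).bind fun σ => I.run π (List.ofFn σ)

/-- The probability that product `j` is accepted, under uniformly random batch order. -/
def acceptProb (π : Policy N T) (j : N) : ℝ :=
  ((I.law π).toOuterMeasure {h | j ∈ accepted h}).toReal

open Classical in
/-- The total fractional value of the products in batch `t` whose bundle meets that of `j`. -/
def localMass (t : Fin T) (j : N) : ℝ :=
  ∑ j' with I.batch j' = t ∧ ¬ Disjoint (I.bundle j') (I.bundle j), I.x j'

theorem localMass_mem (t : Fin T) (j : N) : I.localMass t j ∈ Set.Icc (0 : ℝ) 1 := by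
  classical
  refine ⟨Finset.sum_nonneg fun j' _ => I.x_nonneg j', le_trans ?_ (I.batch_le_one t)⟩
  refine Finset.sum_le_sum_of_subset_of_nonneg (fun j' hj' => ?_) fun j' _ _ => I.x_nonneg j'
  simp only [Finset.mem_filter] at hj' ⊢
  exact ⟨hj'.1, hj'.2.1⟩

end Input

set_option linter.checkUnivs false in
/-- A random-element random-order contention resolution scheme for `L`-bounded products: an online
selection rule for every input. -/
def RCRS (L : ℕ) : Type (max (u + 1) (v + 1)) :=
  ∀ (M : Type u) (N : Type v) [Fintype N] (T : ℕ) (_ : Input M N T L), Policy N T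

/-- The scheme accepts every product `j` of every input with probability at least `α * x j` if the
batches arrive in uniformly random order. -/
def IsSelectable {L : ℕ} (α : ℝ) (R : RCRS.{u, v} L) : Prop :=
  ∀ (M : Type u) (N : Type v) [Fintype N] (T : ℕ) (I : Input M N T L) (j : N),
    α * I.x j ≤ I.acceptProb (R M N T I) j

/-- The attenuation function. -/
def attenuation (L : ℕ) (x : ℝ) : ℝ :=
  ((L - x) * (1 - Real.exp (-L))) / (L * (1 - Real.exp (-(L - x))))

theorem attenuation_mem (L : ℕ) {x : ℝ} (hx : x ∈ Set.Icc (0 : ℝ) 1) :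
    attenuation L x ∈ Set.Icc (0 : ℝ) 1 := by
  unfold attenuation
  rcases Nat.eq_zero_or_pos L with rfl | hL
  · simp
  have hL1 : (1 : ℝ) ≤ L := by exact_mod_cast hL
  have hu : (0 : ℝ) ≤ L - x := by linarith [hx.2]
  have h1 : Real.exp (-(L : ℝ)) ≤ 1 := Real.exp_le_one_iff.2 (by linarith)
  have h2 : Real.exp (-(L - x)) ≤ 1 := Real.exp_le_one_iff.2 (by linarith)
  have hL0 : (L : ℝ) ≠ 0 := by linarith
  have hden : 0 ≤ (L : ℝ) * (1 - Real.exp (-(L - x))) :=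
    mul_nonneg (by linarith) (by linarith)
  refine ⟨div_nonneg (mul_nonneg hu (by linarith)) hden, div_le_one_of_le₀ ?_ hden⟩
  have hc := convexOn_exp.2 (Set.mem_univ (0 : ℝ)) (Set.mem_univ (-(L : ℝ)))
    (sub_nonneg.2 (div_le_one_of_le₀ (by linarith [hx.1]) (by linarith)) :
      0 ≤ 1 - ((L : ℝ) - x) / (L : ℝ))
    (div_nonneg hu (by linarith) : 0 ≤ ((L : ℝ) - x) / (L : ℝ)) (by ring)
  have he : ((L : ℝ) - x) / (L : ℝ) * -(L : ℝ) = -(L - x) := by field_simp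
  simp only [smul_eq_mul, mul_zero, zero_add, Real.exp_zero, mul_one, he] at hc
  have hm := mul_le_mul_of_nonneg_left hc (by linarith : (0 : ℝ) ≤ L)
  have hr : (L : ℝ) * (1 - ((L : ℝ) - x) / (L : ℝ) + ((L : ℝ) - x) / (L : ℝ) * Real.exp (-L))
      = L - (L - x) + (L - x) * Real.exp (-L) := by field_simp
  nlinarith

/-- The attenuate-greedy scheme: an active and feasible product `j` of batch `t` is accepted exactly
if an independent coin of bias `attenuation L (localMass t j)` shows heads. -/
def attenuateGreedy (L : ℕ) : RCRS.{u, v} L := fun _ _ _ _ I _ j =>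
  ⟨attenuation L (I.localMass (I.batch j) j), attenuation_mem L (I.localMass_mem _ j)⟩

/-- The selection guarantee, for `L ≥ 2`. -/
def guarantee (L : ℕ) : ℝ :=
  if L = 2 then
    (3 - 6 * Real.exp (1 / 2) + Real.exp 1 + 8 * Real.exp (3 / 2) + 21 * Real.exp 2
        + 14 * Real.exp (5 / 2) + 7 * Real.exp 3)
      / (16 * Real.exp 1 * (1 + Real.exp (1 / 2) + Real.exp 1) ^ 2)
  else
    ((Real.exp L - Real.exp (1 / L))
        * (1 - (1 + ((Real.exp L - 1) * ((L : ℝ) ^ 2 - 1))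
            / ((Real.exp (1 / L) - Real.exp L) * (L : ℝ) ^ 2)) ^ L))
      / ((Real.exp L - Real.exp 1) * (1 + L))

end RandomElement

end

noncomputable section

namespace RandomElement

open scoped ENNReal

/-! Fix a product j. Let x be the conflicting mass of its own batch and m_s that of another batch s;
let q_s be the probability that the active product of s conflicts with j and its coin shows heads.
Whatever the past, s destroys the feasibility of j with probability at most q_s. So j is feasible on
arrival with probability at least the product of 1 - q_s over the earlier batches, and averaging
over the orders gives the integral of ∏ (1 - y q_s) over y in [0, 1] (`sum_perm_prod_before`,
`Input.le_acceptProb`).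

Let b be the attenuation function and c = 1 - b(1/L). Charge every conflicting product of s to an
item it shares with j. Products charged to the same item conflict with each other, so they are
attenuated at least according to the mass of that item. As b decreases and v b(v) is concave, Jensen
gives q_s ≤ m_s b(m_s/L), and convexity of b near 0 gives q_s ≤ m_s - c m_s²
(`Input.blockRate_le_blocking`).

The masses m_s sum to at most L - x. An exchange argument, valid because c (L + 3) ≤ 1, shows that
the integral is smallest for L - 1 full batches and one of mass 1 - x (`exchange`,
`integral_concentrated_le`). It remains to minimise b(x) times this integral over x
(`guarantee_le_concentratedBound`): the guarantee is its value at x = 0 if L = 2, and at x = 1 if L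
≥ 3. -/

/-! ### Monotonicity, concavity and convexity of the attenuation function -/

/-- The value `1 / (e ^ (L - v) - 1)`, in terms of which the attenuation function and its
derivatives are polynomial. -/
def expRecip (L : ℕ) (v : ℝ) : ℝ := (Real.exp (L - v) - 1)⁻¹

theorem one_lt_exp_sub {L : ℕ} {v : ℝ} (hv : v < L) : 0 < Real.exp (L - v) - 1 := by
  have : 1 < Real.exp (L - v) := Real.one_lt_exp_iff.2 (by linarith)
  linarith

theorem expRecip_pos {L : ℕ} {v : ℝ} (hv : v < L) : 0 < expRecip L v :=
  inv_pos.2 (one_lt_exp_sub hv)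

theorem attenuation_eq {L : ℕ} {v : ℝ} (hv : v < L) :
    attenuation L v = (1 - Real.exp (-L)) / L * ((L - v) * (1 + expRecip L v)) := by
  have h := one_lt_exp_sub hv
  have hd : (1 - Real.exp (-(L - v)))⁻¹ = 1 + expRecip L v := by
    rw [expRecip, Real.exp_neg]
    have : Real.exp (L - v) ≠ 0 := (Real.exp_pos _).ne'
    have h' : Real.exp (L - v) - 1 ≠ 0 := h.ne'
    field_simp
    ring
  rw [attenuation, ← hd, div_eq_mul_inv, mul_inv]
  ring

theorem hasDerivAt_expRecip {L : ℕ} {v : ℝ} (hv : v < L) :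
    HasDerivAt (expRecip L) (expRecip L v * (1 + expRecip L v)) v := by
  have h := one_lt_exp_sub hv
  have h1 : HasDerivAt (fun v : ℝ => Real.exp (L - v) - 1) (Real.exp (L - v) * (-1)) v :=
    (((hasDerivAt_id v).const_sub (L : ℝ)).exp).sub_const 1
  refine (h1.inv h.ne').congr_deriv ?_
  have h' : Real.exp (L - v) - 1 ≠ 0 := h.ne'
  rw [expRecip]
  field_simp
  ring

/-- With u = L - v this is e^u ≥ 1 + u + u²/2. It is the only estimate of the exponential behind the
monotonicity of b and the concavity of v b(v). -/
theorem expRecip_mul_le {L : ℕ} {v : ℝ} (hv : v < L) :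
    (L - v) * expRecip L v * (2 + (L - v)) ≤ 2 := by
  have h := one_lt_exp_sub hv
  have h2 := Real.quadratic_le_exp_of_nonneg (x := L - v) (by linarith)
  have : (L - v) * expRecip L v * (2 + (L - v)) =
      ((L - v) * (2 + (L - v))) / (Real.exp (L - v) - 1) := by
    rw [expRecip]; ring
  rw [this, div_le_iff₀ h]
  nlinarith

theorem attenuation_const_pos {L : ℕ} (hL : 2 ≤ L) : 0 < (1 - Real.exp (-L)) / (L : ℝ) := by
  have hL' : (2 : ℝ) ≤ L := by exact_mod_cast hL
  have : Real.exp (-(L : ℝ)) < 1 := Real.exp_lt_one_iff.2 (by linarith)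
  exact div_pos (by linarith) (by linarith)

theorem hasDerivAt_attenuation {L : ℕ} {v : ℝ} (hv : v < L) :
    HasDerivAt (fun v => (L - v) * (1 + expRecip L v))
      ((1 + expRecip L v) * ((L - v) * expRecip L v - 1)) v := by
  have h := ((hasDerivAt_id v).const_sub (L : ℝ)).mul ((hasDerivAt_expRecip hv).const_add 1)
  exact h.congr_deriv (by simp only [id]; ring)

theorem antitoneOn_attenuation {L : ℕ} (hL : 2 ≤ L) :
    AntitoneOn (attenuation L) (Set.Icc 0 1) := by
  have hL' : (2 : ℝ) ≤ L := by exact_mod_cast hL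
  have hlt : ∀ v ∈ Set.Icc (0 : ℝ) 1, v < L := fun v hv => by linarith [hv.2]
  have key : AntitoneOn (fun v => (L - v) * (1 + expRecip L v)) (Set.Icc 0 1) := by
    refine antitoneOn_of_hasDerivWithinAt_nonpos (convex_Icc 0 1)
      (fun v hv => (hasDerivAt_attenuation (hlt v hv)).continuousAt.continuousWithinAt)
      (fun v hv => (hasDerivAt_attenuation (hlt v (interior_subset hv))).hasDerivWithinAt) ?_
    intro v hv
    have hv' := hlt v (interior_subset hv)
    have h1 := expRecip_pos hv'
    have h2 := expRecip_mul_le hv'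
    have h3 : 0 < (L - v) * expRecip L v := mul_pos (by linarith) h1
    have : 0 < L - v := by linarith
    refine mul_nonpos_of_nonneg_of_nonpos (by linarith) ?_
    nlinarith
  intro a ha b hb hab
  rw [attenuation_eq (hlt a ha), attenuation_eq (hlt b hb)]
  exact mul_le_mul_of_nonneg_left (key ha hb hab) (attenuation_const_pos hL).le

theorem concaveOn_mul_attenuation {L : ℕ} (hL : 2 ≤ L) :
    ConcaveOn ℝ (Set.Icc 0 1) (fun v => v * attenuation L v) := by
  have hL' : (2 : ℝ) ≤ L := by exact_mod_cast hL
  have hlt : ∀ v ∈ Set.Icc (0 : ℝ) 1, v < L := fun v hv => by linarith [hv.2]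
  have hd1 : ∀ v ∈ Set.Icc (0 : ℝ) 1, HasDerivAt (fun v => v * ((L - v) * (1 + expRecip L v)))
      ((1 + expRecip L v) * ((L - v) - v + (L - v) * v * expRecip L v)) v := by
    intro v hv
    exact ((hasDerivAt_id v).mul (hasDerivAt_attenuation (hlt v hv))).congr_deriv
      (by simp only [id]; ring)
  have hd2 : ∀ v ∈ Set.Icc (0 : ℝ) 1,
      HasDerivAt (fun v => (1 + expRecip L v) * ((L - v) - v + (L - v) * v * expRecip L v))
      ((1 + expRecip L v) * (2 * expRecip L v * ((L - v) - v)
        + 2 * (L - v) * v * expRecip L v ^ 2 - 2 + (L - v) * v * expRecip L v)) v := by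
    intro v hv
    have hp := hasDerivAt_expRecip (hlt v hv)
    have hu := (hasDerivAt_id v).const_sub (L : ℝ)
    have hi := hasDerivAt_id v
    exact ((hp.const_add 1).mul ((hu.sub hi).add ((hu.mul hi).mul hp))).congr_deriv
      (by simp only [id, Pi.add_apply, Pi.sub_apply, Pi.mul_apply]; ring)
  have key : ConcaveOn ℝ (Set.Icc 0 1) (fun v => v * ((L - v) * (1 + expRecip L v))) := by
    refine concaveOn_of_hasDerivWithinAt2_nonpos (convex_Icc 0 1)
      (fun v hv => (hd1 v hv).continuousAt.continuousWithinAt)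
      (fun v hv => (hd1 v (interior_subset hv)).hasDerivWithinAt)
      (fun v hv => (hd2 v (interior_subset hv)).hasDerivWithinAt) ?_
    intro v hv
    have hvI := interior_subset hv
    have hv' := hlt v hvI
    have hp := expRecip_pos hv'
    have h2 := expRecip_mul_le hv'
    have hu : 0 < L - v := by linarith
    refine mul_nonpos_of_nonneg_of_nonpos (by linarith) ?_
    generalize (L : ℝ) - v = u at *
    generalize expRecip L v = p at *
    -- Here u = L - v and p = `expRecip L v`. The bracket is 2up - 2 + vp(u - 2 + 2up); multiplied
    -- by 2 + u, it is at most -2u + pu² ≤ 0, by up(2 + u) ≤ 2.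
    have h3 : v * p * (u - 2 + 2 * (u * p)) * (2 + u) ≤ v * p * u ^ 2 := by
      have : (u - 2 + 2 * (u * p)) * (2 + u) ≤ u ^ 2 := by nlinarith
      have h4 : 0 ≤ v * p := mul_nonneg hvI.1 hp.le
      nlinarith
    have h5 : v * p * u ^ 2 ≤ p * u ^ 2 := by
      have := mul_nonneg hp.le (sq_nonneg u)
      nlinarith [hvI.2]
    have h6 : (2 * p * (u - v) + 2 * u * v * p ^ 2 - 2 + u * v * p) * (2 + u) ≤ 0 := by
      have h7 : u * (u * p) ≤ 2 * u := by
        have : 0 < u * p := mul_pos hu hp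
        have : u * p ≤ 1 := by nlinarith
        nlinarith
      nlinarith
    by_contra hcon
    push Not at hcon
    nlinarith [mul_pos hcon (by linarith : (0 : ℝ) < 2 + u)]
  refine (key.smul (attenuation_const_pos hL).le).congr ?_
  intro v hv
  simp only [smul_eq_mul]
  rw [attenuation_eq (hlt v hv)]
  ring

/-- The left side is u coth(u/2) with u = L - v; the bound is the sign condition for convexity of b.
Only u < 2 needs work, where it becomes e^u (2 - u) ≤ 2 + u, and u ≥ 3/2 leaves room for a crude
tangent bound on e^(2 - u). -/
theorem two_le_mul_expRecip {L : ℕ} {v : ℝ} (hL : 2 ≤ L) (hv : v ∈ Set.Icc (0 : ℝ) (1 / 2)) :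
    2 ≤ (L - v) * (1 + 2 * expRecip L v) := by
  have hL' : (2 : ℝ) ≤ L := by exact_mod_cast hL
  have hlt : v < L := by linarith [hv.2]
  have hp := expRecip_pos hlt
  have hu : 3 / 2 ≤ L - v := by linarith [hv.2]
  rcases le_or_gt 2 ((L : ℝ) - v) with h | h
  · nlinarith
  have he := one_lt_exp_sub hlt
  have hm : (L - v) * (1 + 2 * expRecip L v) =
      ((L - v) * (Real.exp (L - v) + 1)) / (Real.exp (L - v) - 1) := by
    rw [expRecip]
    field_simp
    ring
  rw [hm, le_div_iff₀ he]
  generalize (L : ℝ) - v = u at *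
  have h2 : Real.exp u * (3 - u) ≤ Real.exp 2 := by
    have h3 : 3 - u ≤ Real.exp (2 - u) := by linarith [Real.add_one_le_exp (2 - u)]
    calc Real.exp u * (3 - u) ≤ Real.exp u * Real.exp (2 - u) := by gcongr
      _ = Real.exp 2 := by rw [← Real.exp_add]; congr 1; ring
  have h4 : Real.exp 2 < 7.4 := by
    have : Real.exp 2 = Real.exp 1 ^ 2 := by rw [← Real.exp_nat_mul]; norm_num
    rw [this]
    have := Real.exp_one_lt_d9
    have := Real.exp_pos 1
    nlinarith
  have h5 : Real.exp u * (2 - u) ≤ 2 + u := by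
    refine le_of_mul_le_mul_right ?_ (by linarith : (0 : ℝ) < 3 - u)
    nlinarith
  linarith

theorem convexOn_attenuation {L : ℕ} (hL : 2 ≤ L) :
    ConvexOn ℝ (Set.Icc 0 (1 / 2)) (attenuation L) := by
  have hL' : (2 : ℝ) ≤ L := by exact_mod_cast hL
  have hlt : ∀ v ∈ Set.Icc (0 : ℝ) (1 / 2), v < L := fun v hv => by linarith [hv.2]
  have hd2 : ∀ v ∈ Set.Icc (0 : ℝ) (1 / 2),
      HasDerivAt (fun v => (1 + expRecip L v) * ((L - v) * expRecip L v - 1))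
      ((1 + expRecip L v) * expRecip L v * ((L - v) * (1 + 2 * expRecip L v) - 2)) v := by
    intro v hv
    have hp := hasDerivAt_expRecip (hlt v hv)
    have hu := (hasDerivAt_id v).const_sub (L : ℝ)
    exact ((hp.const_add 1).mul ((hu.mul hp).sub_const 1)).congr_deriv
      (by simp only [id, Pi.mul_apply]; ring)
  have key : ConvexOn ℝ (Set.Icc 0 (1 / 2)) (fun v => (L - v) * (1 + expRecip L v)) := by
    refine convexOn_of_hasDerivWithinAt2_nonneg (convex_Icc 0 (1 / 2))
      (fun v hv => (hasDerivAt_attenuation (hlt v hv)).continuousAt.continuousWithinAt)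
      (fun v hv => (hasDerivAt_attenuation (hlt v (interior_subset hv))).hasDerivWithinAt)
      (fun v hv => (hd2 v (interior_subset hv)).hasDerivWithinAt) ?_
    intro v hv
    have hp := expRecip_pos (hlt v (interior_subset hv))
    have := two_le_mul_expRecip hL (interior_subset hv)
    exact mul_nonneg (mul_nonneg (by linarith) hp.le) (by linarith)
  refine (key.smul (attenuation_const_pos hL).le).congr ?_
  intro v hv
  simp only [smul_eq_mul]
  rw [attenuation_eq (hlt v hv)]

theorem attenuation_zero {L : ℕ} (hL : 2 ≤ L) : attenuation L 0 = 1 := by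
  have h := attenuation_const_pos hL
  have hL' : (2 : ℝ) ≤ L := by exact_mod_cast hL
  rw [attenuation, sub_zero, div_self]
  have : Real.exp (-(L : ℝ)) < 1 := Real.exp_lt_one_iff.2 (by linarith)
  exact (mul_pos (by linarith) (by linarith)).ne'

/-- The loss of the attenuation function at `1 / L`. -/
def loss (L : ℕ) : ℝ := 1 - attenuation L (1 / L)

/-- A convex function lies below its chord, here the one from 0 to 1/L. Since 1/L ≤ 1/2, convexity
on [0, 1/2] suffices. -/
theorem attenuation_div_le {L : ℕ} (hL : 2 ≤ L) {m : ℝ} (hm : m ∈ Set.Icc (0 : ℝ) 1) :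
    attenuation L (m / L) ≤ 1 - loss L * m := by
  have hL' : (2 : ℝ) ≤ L := by exact_mod_cast hL
  have h1 : (1 / L : ℝ) ∈ Set.Icc (0 : ℝ) (1 / 2) :=
    ⟨by positivity, one_div_le_one_div_of_le (by norm_num) hL'⟩
  have h := (convexOn_attenuation hL).2 (x := 0) ⟨le_rfl, by norm_num⟩ h1
    (sub_nonneg.2 hm.2) hm.1 (by ring)
  simp only [smul_eq_mul, mul_zero, zero_add, attenuation_zero hL, mul_one_div] at h
  rw [loss]
  linarith

theorem one_div_mem {L : ℕ} (hL : 2 ≤ L) : (1 / L : ℝ) ∈ Set.Icc (0 : ℝ) 1 := by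
  have hL' : (1 : ℝ) ≤ L := by exact_mod_cast (by omega : 1 ≤ L)
  exact ⟨by positivity, (div_le_one (by linarith)).2 hL'⟩

theorem loss_nonneg {L : ℕ} (hL : 2 ≤ L) : 0 ≤ loss L :=
  sub_nonneg.2 (attenuation_mem L (one_div_mem hL)).2

theorem attenuation_eq_exp {L : ℕ} (hL : 2 ≤ L) {v : ℝ} (hv : v ∈ Set.Icc (0 : ℝ) 1) :
    attenuation L v = (L - v) * (Real.exp L - 1) / (L * (Real.exp L - Real.exp v)) := by
  have hL' : (2 : ℝ) ≤ L := by exact_mod_cast hL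
  have h : Real.exp v < Real.exp L := Real.exp_lt_exp.2 (by linarith [hv.2])
  have hp := Real.exp_pos (L : ℝ)
  have h1 : 1 - Real.exp (-(L : ℝ)) = (Real.exp L - 1) / Real.exp L := by
    rw [Real.exp_neg]; field_simp
  have h2 : 1 - Real.exp (-(L - v)) = (Real.exp L - Real.exp v) / Real.exp L := by
    rw [neg_sub, Real.exp_sub]; field_simp
  have h3 : Real.exp L - Real.exp v ≠ 0 := by linarith
  rw [attenuation, h1, h2]
  field_simp

theorem loss_le {L : ℕ} (hL : 2 ≤ L) : loss L ≤ 1 / (L : ℝ) ^ 2 := by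
  have hL' : (2 : ℝ) ≤ L := by exact_mod_cast hL
  rw [loss, attenuation_eq_exp hL (one_div_mem hL)]
  have h : Real.exp (1 / L) < Real.exp L :=
    Real.exp_lt_exp.2 (by linarith [(one_div_mem hL).2])
  have h1 : 1 ≤ Real.exp (1 / (L : ℝ)) := Real.one_le_exp (by positivity)
  have h2 : (1 - 1 / (L : ℝ) ^ 2) ≤
      (L - 1 / L) * (Real.exp L - 1) / (L * (Real.exp L - Real.exp (1 / L))) := by
    rw [le_div_iff₀ (mul_pos (by linarith) (by linarith))]
    have : (1 - 1 / (L : ℝ) ^ 2) * (L * (Real.exp L - Real.exp (1 / L))) =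
      (L - 1 / L) * (Real.exp L - Real.exp (1 / L)) := by field_simp
    rw [this]
    have : 0 ≤ (L : ℝ) - 1 / L := by linarith [(one_div_mem hL).2]
    gcongr
  linarith

/-! ### Slowly decaying weights and their moments -/

/-- A nonnegative function on `[0, 1]` that decays no faster than `(1 - y) ^ S`. -/
structure SlowDecay (S : ℝ) (g : ℝ → ℝ) : Prop where
  contDiff : ContDiff ℝ 1 g
  nonneg : ∀ y ∈ Set.Icc (0 : ℝ) 1, 0 ≤ g y
  slope : ∀ y ∈ Set.Icc (0 : ℝ) 1, 0 ≤ (1 - y) * deriv g y + S * g y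

theorem SlowDecay.mul {S S' : ℝ} {g g' : ℝ → ℝ} (h : SlowDecay S g) (h' : SlowDecay S' g') :
    SlowDecay (S + S') (fun y => g y * g' y) where
  contDiff := h.contDiff.mul h'.contDiff
  nonneg y hy := mul_nonneg (h.nonneg y hy) (h'.nonneg y hy)
  slope y hy := by
    have hd : deriv (fun y => g y * g' y) y = deriv g y * g' y + g y * deriv g' y :=
      deriv_fun_mul (h.contDiff.differentiable one_ne_zero y)
        (h'.contDiff.differentiable one_ne_zero y)
    rw [hd]
    have h1 := mul_nonneg (h'.nonneg y hy) (h.slope y hy)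
    have h2 := mul_nonneg (h.nonneg y hy) (h'.slope y hy)
    linarith

theorem SlowDecay.one : SlowDecay 0 (fun _ => 1) where
  contDiff := contDiff_const
  nonneg _ _ := zero_le_one
  slope y _ := by simp

/-- The slope expression equals (m - q) + yq(1 - m). Thus the decay exponent of a product of batch
factors is at most the total mass of the batches. -/
theorem SlowDecay.one_sub_mul {m q : ℝ} (hm : m ≤ 1) (hq : 0 ≤ q) (hqm : q ≤ m) :
    SlowDecay m (fun y => 1 - y * q) where
  contDiff := by fun_prop
  nonneg y hy := by nlinarith [hy.1, hy.2]
  slope y hy := by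
    have hd : deriv (fun y => 1 - y * q) y = -q := by
      have : HasDerivAt (fun y => 1 - y * q) (-(1 * q)) y :=
        ((hasDerivAt_id y).mul_const q).const_sub 1
      rw [this.deriv, one_mul]
    rw [hd]
    have := mul_nonneg (mul_nonneg hy.1 hq) (sub_nonneg.2 hm)
    nlinarith

theorem SlowDecay.prod {ι : Type*} {s : Finset ι} {S : ι → ℝ} {g : ι → ℝ → ℝ}
    (h : ∀ i ∈ s, SlowDecay (S i) (g i)) :
    SlowDecay (∑ i ∈ s, S i) (fun y => ∏ i ∈ s, g i y) := by
  classical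
  induction s using Finset.induction_on with
  | empty => simpa using SlowDecay.one
  | insert a s ha ih =>
    simp only [Finset.sum_insert ha, Finset.prod_insert ha]
    exact (h a (Finset.mem_insert_self _ _)).mul
      (ih fun i hi => h i (Finset.mem_insert_of_mem hi))

theorem SlowDecay.pow {S : ℝ} {g : ℝ → ℝ} (h : SlowDecay S g) (k : ℕ) :
    SlowDecay (k * S) (fun y => g y ^ k) := by
  simpa using SlowDecay.prod (s := Finset.range k) (fun _ _ => h)

/-- Integrate the derivative of y²(1 - y)g(y): the boundary terms vanish, and the slope condition
bounds y²(1 - y)g' below by -S y² g. -/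
theorem SlowDecay.moment_le {S : ℝ} {g : ℝ → ℝ} (h : SlowDecay S g) :
    2 * ∫ y in (0 : ℝ)..1, y * g y ≤ (S + 3) * ∫ y in (0 : ℝ)..1, y ^ 2 * g y := by
  have hg : Continuous g := h.contDiff.continuous
  have hg' : Continuous (deriv g) := h.contDiff.continuous_deriv le_rfl
  have hd : ∀ y : ℝ, HasDerivAt (fun y => y ^ 2 * (1 - y) * g y)
      ((2 * y - 3 * y ^ 2) * g y + y ^ 2 * ((1 - y) * deriv g y)) y := by
    intro y
    have hy := hasDerivAt_id y
    exact (((hy.pow 2).mul (hy.const_sub 1)).mul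
      (h.contDiff.differentiable one_ne_zero y).hasDerivAt).congr_deriv
      (by simp only [id, Pi.mul_apply, Pi.pow_apply]; push_cast; ring)
  have hparts : ∫ y in (0 : ℝ)..1, ((2 * y - 3 * y ^ 2) * g y + y ^ 2 * ((1 - y) * deriv g y))
      = 0 := by
    rw [intervalIntegral.integral_eq_sub_of_hasDerivAt (fun y _ => hd y)
      (by apply Continuous.intervalIntegrable; fun_prop)]
    simp
  have hle : ∫ y in (0 : ℝ)..1, (2 * (y * g y) - (S + 3) * (y ^ 2 * g y)) ≤
      ∫ y in (0 : ℝ)..1, ((2 * y - 3 * y ^ 2) * g y + y ^ 2 * ((1 - y) * deriv g y)) := by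
    refine intervalIntegral.integral_mono_on zero_le_one
      (by apply Continuous.intervalIntegrable; fun_prop)
      (by apply Continuous.intervalIntegrable; fun_prop) ?_
    intro y hy
    have := mul_nonneg (sq_nonneg y) (h.slope y hy)
    linarith
  rw [hparts, intervalIntegral.integral_sub (by apply Continuous.intervalIntegrable; fun_prop)
    (by apply Continuous.intervalIntegrable; fun_prop),
    intervalIntegral.integral_const_mul, intervalIntegral.integral_const_mul] at hle
  linarith

/-! ### Concentrating the conflicting mass -/

/-- The blocking probability bound of a batch of mass `m`. -/
def blocking (c m : ℝ) : ℝ := m - c * m ^ 2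

theorem blocking_nonneg {c m : ℝ} (hc : c ≤ 1) (hm : m ∈ Set.Icc (0 : ℝ) 1) :
    0 ≤ blocking c m := by
  have := mul_nonneg hm.1 (sub_nonneg.2 hm.2)
  have := mul_le_mul_of_nonneg_right hc (sq_nonneg m)
  rw [blocking]; nlinarith

theorem blocking_le {c m : ℝ} (hc : 0 ≤ c) : blocking c m ≤ m := by
  have := mul_nonneg hc (sq_nonneg m)
  rw [blocking]; linarith

theorem blocking_mono {c a b : ℝ} (hc : c ≤ 1 / 2) (ha : 0 ≤ a) (hab : a ≤ b) (hb : b ≤ 1) :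
    blocking c a ≤ blocking c b := by
  have h : blocking c b - blocking c a = (b - a) * (1 - c * (a + b)) := by
    rw [blocking, blocking]; ring
  have : 0 ≤ 1 - c * (a + b) := by nlinarith
  nlinarith [mul_nonneg (sub_nonneg.2 hab) this]

theorem SlowDecay.blocking {c m : ℝ} (hc : 0 ≤ c) (hc' : c ≤ 1) (hm : m ∈ Set.Icc (0 : ℝ) 1) :
    SlowDecay m (fun y => 1 - y * blocking c m) :=
  .one_sub_mul hm.2 (blocking_nonneg hc' hm) (blocking_le hc)

/-- Spreading two batch masses further apart, at equal sum, lowers the integral. -/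
theorem exchange {c S K : ℝ} {g : ℝ → ℝ} (hg : SlowDecay S g) (hc : 0 ≤ c)
    (hcK : c * (K + 3) ≤ 1) {a b a' b' : ℝ} (hab : a + b = a' + b') (hK : S + (a + b) ≤ K)
    (hle : a' * b' ≤ a * b) (hnn : 0 ≤ a' * b') :
    ∫ y in (0 : ℝ)..1, g y * ((1 - y * blocking c a') * (1 - y * blocking c b')) ≤
      ∫ y in (0 : ℝ)..1, g y * ((1 - y * blocking c a) * (1 - y * blocking c b)) := by
  have hgc : Continuous g := hg.contDiff.continuous
  have hsplit : ∀ p q : ℝ, ∫ y in (0 : ℝ)..1, g y * ((1 - y * p) * (1 - y * q)) =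
      (∫ y in (0 : ℝ)..1, g y) - (p + q) * (∫ y in (0 : ℝ)..1, y * g y)
        + p * q * ∫ y in (0 : ℝ)..1, y ^ 2 * g y := by
    intro p q
    rw [← intervalIntegral.integral_const_mul, ← intervalIntegral.integral_const_mul,
      ← intervalIntegral.integral_sub (by apply Continuous.intervalIntegrable; fun_prop)
        (by apply Continuous.intervalIntegrable; fun_prop),
      ← intervalIntegral.integral_add (by apply Continuous.intervalIntegrable; fun_prop)
        (by apply Continuous.intervalIntegrable; fun_prop)]
    refine intervalIntegral.integral_congr fun y _ => ?_
    ring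
  rw [hsplit, hsplit]
  have hm := hg.moment_le
  have h2 : 0 ≤ ∫ y in (0 : ℝ)..1, y ^ 2 * g y :=
    intervalIntegral.integral_nonneg zero_le_one fun y hy =>
      mul_nonneg (sq_nonneg y) (hg.nonneg y hy)
  generalize ∫ y in (0 : ℝ)..1, y * g y = A₁ at *
  generalize ∫ y in (0 : ℝ)..1, y ^ 2 * g y = A₂ at *
  -- Both coefficient differences carry the factor ab - a'b' ≥ 0. What remains is 2c A₁ ≤ (1 - c(a +
  -- b) + c²(ab + a'b')) A₂, which follows from `moment_le` and c(K + 3) ≤ 1.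
  have e1 : (blocking c a + blocking c b) - (blocking c a' + blocking c b') =
      2 * c * (a * b - a' * b') := by
    have : b' = a + b - a' := by linarith
    subst this; simp only [blocking]; ring
  have e2 : blocking c a * blocking c b - blocking c a' * blocking c b' =
      (a * b - a' * b') * (1 - c * (a + b) + c ^ 2 * (a * b + a' * b')) := by
    have : b' = a + b - a' := by linarith
    subst this; simp only [blocking]; ring
  have h3 : c * (S + 3) ≤ 1 - c * (a + b) + c ^ 2 * (a * b + a' * b') := by
    have : 0 ≤ c ^ 2 * (a * b + a' * b') := by
      have : 0 ≤ a * b + a' * b' := by linarith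
      positivity
    have := mul_le_mul_of_nonneg_left hK hc
    linarith
  have h4 := mul_le_mul_of_nonneg_right h3 h2
  have h5 := mul_le_mul_of_nonneg_left hm hc
  have h6 : 0 ≤ (a * b - a' * b') *
      ((1 - c * (a + b) + c ^ 2 * (a * b + a' * b')) * A₂ - 2 * c * A₁) :=
    mul_nonneg (by linarith) (by linarith)
  linear_combination h6 + e1 * A₁ - e2 * A₂

theorem integral_concentrated_le_base {c x : ℝ} {L k : ℕ} (hL : 1 ≤ L) (hc : 0 ≤ c)
    (hc' : c ≤ 1 / 2) (hx : x ∈ Set.Icc (0 : ℝ) 1) {θ : ℝ} (hθ : θ ∈ Set.Icc (0 : ℝ) 1)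
    (hsum : k + θ ≤ L - x) :
    ∫ y in (0 : ℝ)..1, (1 - y * blocking c 1) ^ (L - 1) * (1 - y * blocking c (1 - x)) ≤
      ∫ y in (0 : ℝ)..1, (1 - y * blocking c 1) ^ k * (1 - y * blocking c θ) := by
  refine intervalIntegral.integral_mono_on zero_le_one
    (by apply Continuous.intervalIntegrable; fun_prop)
    (by apply Continuous.intervalIntegrable; fun_prop) ?_
  intro y hy
  have hx' : 1 - x ∈ Set.Icc (0 : ℝ) 1 := ⟨by linarith [hx.2], by linarith [hx.1]⟩
  have one_mem : (1 : ℝ) ∈ Set.Icc (0 : ℝ) 1 := ⟨zero_le_one, le_rfl⟩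
  have hmem : ∀ m ∈ Set.Icc (0 : ℝ) 1, 0 ≤ y * blocking c m ∧ y * blocking c m ≤ 1 := by
    intro m hm
    have h1 := blocking_nonneg (c := c) (by linarith) hm
    have h2 := (blocking_le (m := m) hc).trans hm.2
    exact ⟨mul_nonneg hy.1 h1, mul_le_one₀ hy.2 h1 h2⟩
  have hβ := hmem 1 one_mem
  have hz := hmem _ hx'
  have hmono : ∀ a b : ℝ, 0 ≤ a → a ≤ b → b ≤ 1 → 1 - y * blocking c b ≤ 1 - y * blocking c a :=
    fun a b ha hab hb => by
      have := mul_le_mul_of_nonneg_left (blocking_mono hc' ha hab hb) hy.1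
      linarith
  set B := 1 - y * blocking c 1 with hB
  have hB0 : 0 ≤ B := by linarith
  have hB1 : B ≤ 1 := by linarith
  -- If k < L - 1, rounding θ up to a full batch still leaves at most L - 1 of them. If k = L - 1,
  -- then θ ≤ 1 - x. If k ≥ L, the mass budget forces k = L and x = θ = 0.
  rcases lt_trichotomy k (L - 1) with h | h | h
  · calc B ^ (L - 1) * (1 - y * blocking c (1 - x)) ≤ B ^ (L - 1) * 1 := by
          refine mul_le_mul_of_nonneg_left ?_ (pow_nonneg hB0 _)
          linarith
      _ ≤ B ^ (k + 1) := by
          rw [mul_one]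
          exact pow_le_pow_of_le_one hB0 hB1 (by omega)
      _ = B ^ k * B := pow_succ _ _
      _ ≤ B ^ k * (1 - y * blocking c θ) :=
          mul_le_mul_of_nonneg_left (hmono _ _ hθ.1 hθ.2 le_rfl) (pow_nonneg hB0 _)
  · rw [h]
    refine mul_le_mul_of_nonneg_left (hmono _ _ hθ.1 ?_ hx'.2) (pow_nonneg hB0 _)
    have : (k : ℝ) + 1 = L := by exact_mod_cast (by omega : k + 1 = L)
    linarith
  · have hkL : (L : ℝ) ≤ k := by exact_mod_cast (by omega : L ≤ k)
    have hx0 : x = 0 := by linarith [hx.1, hθ.1]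
    have hθ0 : θ = 0 := by linarith [hx.1, hθ.1]
    have hk : k = L := by
      have : (k : ℝ) ≤ L := by linarith
      have : k ≤ L := by exact_mod_cast this
      omega
    subst hk hx0 hθ0
    have e : B ^ k = B ^ (k - 1) * B := by rw [← pow_succ]; congr 1; omega
    simp only [sub_zero, blocking, ne_eq, OfNat.ofNat_ne_zero, not_false_eq_true, zero_pow,
      mul_zero, mul_one, e]
    simp [hB, blocking]

/-- Among all ways to distribute the conflicting mass over batches, the integral is smallest if
all batches but one are full. -/
theorem integral_concentrated_le {ι : Type*} {c x : ℝ} {L : ℕ} (hL : 1 ≤ L) (hc : 0 ≤ c)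
    (hcL : c * (L + 3) ≤ 1) (hx : x ∈ Set.Icc (0 : ℝ) 1) (s : Finset ι) (m : ι → ℝ)
    (hm : ∀ i ∈ s, m i ∈ Set.Icc (0 : ℝ) 1) (k : ℕ) (θ : ℝ) (hθ : θ ∈ Set.Icc (0 : ℝ) 1)
    (hsum : k + θ + ∑ i ∈ s, m i ≤ L - x) :
    ∫ y in (0 : ℝ)..1, (1 - y * blocking c 1) ^ (L - 1) * (1 - y * blocking c (1 - x)) ≤
      ∫ y in (0 : ℝ)..1, (1 - y * blocking c 1) ^ k * (1 - y * blocking c θ)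
        * ∏ i ∈ s, (1 - y * blocking c (m i)) := by
  classical
  have hL' : (1 : ℝ) ≤ L := by exact_mod_cast hL
  have hc' : c ≤ 1 / 4 := by nlinarith
  -- The state is k full batches and one partial batch of mass θ. Each further batch is poured into
  -- the partial one, with overflow opening a new partial batch; every pouring is an exchange of two
  -- masses.
  induction s using Finset.induction_on generalizing k θ with
  | empty =>
    simp only [Finset.prod_empty, mul_one]
    exact integral_concentrated_le_base hL hc (by linarith) hx hθ (by simpa using hsum)
  | insert a s ha ih =>
    rw [Finset.sum_insert ha] at hsum
    have hms : ∀ i ∈ s, m i ∈ Set.Icc (0 : ℝ) 1 := fun i hi => hm i (Finset.mem_insert_of_mem hi)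
    have hma := hm a (Finset.mem_insert_self _ _)
    have hg : SlowDecay (k * 1 + ∑ i ∈ s, m i)
        (fun y => (1 - y * blocking c 1) ^ k * ∏ i ∈ s, (1 - y * blocking c (m i))) :=
      ((SlowDecay.blocking hc (by linarith) ⟨zero_le_one, le_rfl⟩).pow k).mul
        (SlowDecay.prod fun i hi => SlowDecay.blocking hc (by linarith) (hms i hi))
    have hrw : ∫ y in (0 : ℝ)..1, (1 - y * blocking c 1) ^ k * (1 - y * blocking c θ)
        * ∏ i ∈ insert a s, (1 - y * blocking c (m i)) =
        ∫ y in (0 : ℝ)..1, ((1 - y * blocking c 1) ^ k * ∏ i ∈ s, (1 - y * blocking c (m i)))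
          * ((1 - y * blocking c θ) * (1 - y * blocking c (m a))) := by
      refine intervalIntegral.integral_congr fun y _ => ?_
      simp only [Finset.prod_insert ha]
      ring
    rw [hrw]
    rcases le_total (θ + m a) 1 with h | h
    · refine (ih hms k (θ + m a) ⟨add_nonneg hθ.1 hma.1, h⟩ (by linarith)).trans ?_
      refine le_of_eq_of_le ?_ (exchange (a' := θ + m a) (b' := 0) (K := L) hg hc hcL (by ring)
        (by linarith [hx.1]) (by simpa using mul_nonneg hθ.1 hma.1) (by simp))
      refine intervalIntegral.integral_congr fun y _ => ?_
      simp [blocking]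
      ring
    · refine (ih hms (k + 1) (θ + m a - 1) ⟨by linarith, by linarith [hθ.2, hma.2]⟩
        (by push_cast; linarith)).trans ?_
      refine le_of_eq_of_le ?_ (exchange (a' := 1) (b' := θ + m a - 1) (K := L) hg hc hcL (by ring)
        (by linarith [hx.1])
        (by nlinarith [mul_nonneg (sub_nonneg.2 hθ.2) (sub_nonneg.2 hma.2)]) (by linarith))
      refine intervalIntegral.integral_congr fun y _ => ?_
      simp only [pow_succ]
      ring

/-! ### Minimising over the mass of the own batch -/

/-- The lower bound on the selection probability of a product, relative to its fractional value,
whose own batch has conflicting mass `x`, if the remaining mass is as concentrated as possible. -/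
def concentratedBound (L : ℕ) (x : ℝ) : ℝ :=
  attenuation L x * ∫ y in (0 : ℝ)..1,
    (1 - y * blocking (loss L) 1) ^ (L - 1) * (1 - y * blocking (loss L) (1 - x))

theorem blocking_one (c : ℝ) : blocking c 1 = 1 - c := by simp [blocking]

theorem integral_one_sub_pow (β : ℝ) (n : ℕ) :
    β * (n + 1) * ∫ y in (0 : ℝ)..1, (1 - y * β) ^ n = 1 - (1 - β) ^ (n + 1) := by
  have hd : ∀ y : ℝ, HasDerivAt (fun y => -(1 - y * β) ^ (n + 1))
      (β * (n + 1) * (1 - y * β) ^ n) y := by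
    intro y
    have h1 : HasDerivAt (fun y => 1 - y * β) (-(1 * β)) y :=
      ((hasDerivAt_id y).mul_const β).const_sub 1
    exact (h1.pow (n + 1)).neg.congr_deriv (by push_cast; simp; ring)
  rw [← intervalIntegral.integral_const_mul,
    intervalIntegral.integral_eq_sub_of_hasDerivAt (fun y _ => hd y)
      (by apply Continuous.intervalIntegrable; fun_prop)]
  simp
  ring

theorem integral_mul_one_sub_pow (β : ℝ) (n : ℕ) :
    (∫ y in (0 : ℝ)..1, (1 - y * β) ^ n)
      - β * (n + 2) * ∫ y in (0 : ℝ)..1, y * (1 - y * β) ^ n = (1 - β) ^ (n + 1) := by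
  have hd : ∀ y : ℝ, HasDerivAt (fun y => y * (1 - y * β) ^ (n + 1))
      ((1 - y * β) ^ n - β * (n + 2) * (y * (1 - y * β) ^ n)) y := by
    intro y
    have h1 : HasDerivAt (fun y => 1 - y * β) (-(1 * β)) y :=
      ((hasDerivAt_id y).mul_const β).const_sub 1
    exact ((hasDerivAt_id y).mul (h1.pow (n + 1))).congr_deriv
      (by push_cast; simp [pow_succ]; ring)
  rw [← intervalIntegral.integral_const_mul,
    ← intervalIntegral.integral_sub (by apply Continuous.intervalIntegrable; fun_prop)
      (by apply Continuous.intervalIntegrable; fun_prop),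
    intervalIntegral.integral_eq_sub_of_hasDerivAt (fun y _ => hd y)
      (by apply Continuous.intervalIntegrable; fun_prop)]
  simp

theorem concentratedBound_eq (L : ℕ) (x : ℝ) :
    concentratedBound L x = attenuation L x *
      ((∫ y in (0 : ℝ)..1, (1 - y * (1 - loss L)) ^ (L - 1)) - blocking (loss L) (1 - x) *
        ∫ y in (0 : ℝ)..1, y * (1 - y * (1 - loss L)) ^ (L - 1)) := by
  rw [concentratedBound, blocking_one, ← intervalIntegral.integral_const_mul (blocking _ _),
    ← intervalIntegral.integral_sub (by apply Continuous.intervalIntegrable; fun_prop)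
      (by apply Continuous.intervalIntegrable; fun_prop)]
  congr 1
  refine intervalIntegral.integral_congr fun y _ => ?_
  ring

/-- Used at n = L - 1 in `attenuation_growth`. It fails at n = 1, so this route does not cover L =
2. -/
theorem one_add_mul_le_exp (n : ℕ) (hn : 2 ≤ n) : 1 + (n : ℝ) * (n + 1) ≤ Real.exp n := by
  have he := Real.exp_one_gt_d9
  induction n, hn using Nat.le_induction with
  | base =>
    have : Real.exp ((2 : ℕ) : ℝ) = Real.exp 1 ^ 2 := by rw [← Real.exp_nat_mul]; norm_num
    rw [this]
    push_cast
    nlinarith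
  | succ n hn ih =>
    have hn' : (2 : ℝ) ≤ n := by exact_mod_cast hn
    push_cast
    rw [Real.exp_add]
    have : (1 + (n : ℝ) * (n + 1)) * 2.7 ≤ Real.exp n * Real.exp 1 := by
      gcongr
      linarith
    nlinarith

theorem le_exp_neg {z : ℝ} (hz : z ∈ Set.Icc (0 : ℝ) 1) : 1 - z + z ^ 2 / 3 ≤ Real.exp (-z) := by
  have h := (abs_le.1 (Real.exp_bound (x := -z) (n := 5)
    (by rw [abs_neg, abs_of_nonneg hz.1]; exact hz.2) (by norm_num))).1
  rw [abs_neg, abs_of_nonneg hz.1] at h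
  norm_num [Finset.sum_range_succ, Nat.factorial] at h
  have h3 : z ^ 3 ≤ z ^ 2 := pow_le_pow_of_le_one hz.1 hz.2 (by norm_num)
  have h5 : z ^ 5 ≤ z ^ 4 := pow_le_pow_of_le_one hz.1 hz.2 (by norm_num)
  have h4 : 0 ≤ z ^ 4 := pow_nonneg hz.1 4
  nlinarith

/-- Quantifies the gain in b from an own batch of conflicting mass 1 - z instead of 1. After
clearing denominators, e^(-z) ≥ 1 - z + z²/3 and e^(L - 1) ≥ 1 + L(L - 1) suffice. -/
theorem attenuation_growth {L : ℕ} (hL : 3 ≤ L) {z : ℝ} (hz : z ∈ Set.Icc (0 : ℝ) 1) :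
    attenuation L 1 * (1 + z / L) ≤ attenuation L (1 - z) := by
  have hL' : (3 : ℝ) ≤ L := by exact_mod_cast hL
  have hE := one_add_mul_le_exp (L - 1) (by omega)
  rw [Nat.cast_sub (by omega)] at hE
  push_cast at hE
  have hδ := le_exp_neg hz
  have hδ1 : Real.exp (-z) ≤ 1 := Real.exp_le_one_iff.2 (by linarith [hz.1])
  have hκ : 0 ≤ 1 - Real.exp (-(L : ℝ)) :=
    sub_nonneg.2 (Real.exp_le_one_iff.2 (by linarith))
  have e1 : Real.exp (-((L : ℝ) - 1)) = 1 / Real.exp (L - 1) := by rw [Real.exp_neg, one_div]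
  have e2 : Real.exp (-((L : ℝ) - (1 - z))) = Real.exp (-z) / Real.exp (L - 1) := by
    rw [← Real.exp_sub]; congr 1; ring
  rw [attenuation, attenuation, e1, e2]
  generalize Real.exp ((L : ℝ) - 1) = E at *
  generalize Real.exp (-z) = δ at *
  generalize 1 - Real.exp (-(L : ℝ)) = κ at *
  have hE7 : 7 ≤ E := by nlinarith
  have key : (L - 1) * (L + z) * (E - δ) ≤ L * (L - 1 + z) * (E - 1) := by
    have h1 : (L + z) * (1 - z / 3) ≤ L := by nlinarith [mul_nonneg hz.1 (sub_nonneg.2 hL'), hz.1]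
    have h2 : (L - 1) * ((L + z) * (1 - z / 3)) ≤ E - 1 := by
      have := mul_le_mul_of_nonneg_left h1 (by linarith : (0 : ℝ) ≤ L - 1)
      linarith
    have h3 := mul_le_mul_of_nonneg_left h2 hz.1
    have h4 : (L - 1) * (L + z) * (E - δ) ≤ (L - 1) * (L + z) * (E - (1 - z + z ^ 2 / 3)) := by
      refine mul_le_mul_of_nonneg_left (by linarith)
        (mul_nonneg (by linarith) (by linarith [hz.1]))
    nlinarith
  have hE0 : 0 < E := by linarith
  have r1 : (L - 1) * κ / (L * (1 - 1 / E)) * (1 + z / L) =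
      (κ * E / L) * ((L - 1) * (L + z) / (L * (E - 1))) := by
    have : E - 1 ≠ 0 := by linarith
    field_simp
  have r2 : (L - (1 - z)) * κ / (L * (1 - δ / E)) = (κ * E / L) * ((L - 1 + z) / (E - δ)) := by
    have : E - δ ≠ 0 := by linarith
    field_simp
    ring
  rw [r1, r2]
  refine mul_le_mul_of_nonneg_left ?_ (by positivity)
  rw [div_le_div_iff₀ (mul_pos (by linarith) (by linarith)) (by linarith)]
  linarith

theorem guarantee_eq {L : ℕ} (hL : 3 ≤ L) : guarantee L =
    (Real.exp L - Real.exp (1 / L)) * (1 - loss L ^ L) / ((Real.exp L - Real.exp 1) * (1 + L)) := by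
  have hL' : (3 : ℝ) ≤ L := by exact_mod_cast hL
  have h : Real.exp (1 / (L : ℝ)) < Real.exp L :=
    Real.exp_lt_exp.2 (by linarith [(one_div_mem (by omega : 2 ≤ L)).2])
  have hb : 1 + ((Real.exp L - 1) * ((L : ℝ) ^ 2 - 1))
      / ((Real.exp (1 / L) - Real.exp L) * (L : ℝ) ^ 2) = loss L := by
    rw [loss, attenuation_eq_exp (by omega) (one_div_mem (by omega : 2 ≤ L))]
    have h1 : Real.exp L - Real.exp (1 / (L : ℝ)) ≠ 0 := by linarith
    have h2 : Real.exp (1 / (L : ℝ)) - Real.exp L ≠ 0 := by linarith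
    have h3 : (L : ℝ) ≠ 0 := by linarith
    rw [← neg_sub (Real.exp (L : ℝ)) (Real.exp (1 / (L : ℝ)))]
    generalize Real.exp L - Real.exp (1 / (L : ℝ)) = d at *
    field_simp
    ring
  rw [guarantee, if_neg (by omega), hb]

/-- The right side is `concentratedBound L 1`, since an empty batch blocks nothing. -/
theorem guarantee_eq_mul_integral {L : ℕ} (hL : 3 ≤ L) : guarantee L =
    attenuation L 1 * ∫ y in (0 : ℝ)..1, (1 - y * (1 - loss L)) ^ (L - 1) := by
  have hL' : (3 : ℝ) ≤ L := by exact_mod_cast hL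
  have h : Real.exp (1 / (L : ℝ)) < Real.exp L :=
    Real.exp_lt_exp.2 (by linarith [(one_div_mem (by omega : 2 ≤ L)).2])
  have h' : Real.exp 1 < Real.exp L := Real.exp_lt_exp.2 (by linarith)
  have h'' : 1 < Real.exp L := Real.one_lt_exp_iff.2 (by linarith)
  have hI := integral_one_sub_pow (1 - loss L) (L - 1)
  rw [sub_sub_cancel, Nat.sub_add_cancel (by omega), Nat.cast_sub (by omega)] at hI
  rw [guarantee_eq hL, ← hI, attenuation_eq_exp (by omega) ⟨zero_le_one, le_rfl⟩]
  generalize ∫ y in (0 : ℝ)..1, (1 - y * (1 - loss L)) ^ (L - 1) = I₀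
  rw [loss, sub_sub_cancel, attenuation_eq_exp (by omega) (one_div_mem (by omega : 2 ≤ L))]
  have h1 : Real.exp L - Real.exp (1 / (L : ℝ)) ≠ 0 := by linarith
  have h2 : Real.exp L - Real.exp 1 ≠ 0 := by linarith
  have h3 : (1 : ℝ) + L ≠ 0 := by linarith
  generalize Real.exp L - Real.exp (1 / (L : ℝ)) = d at *
  generalize Real.exp L - Real.exp 1 = d' at *
  field_simp
  push_cast
  ring

theorem loss_mul_le {L : ℕ} (hL : 3 ≤ L) : loss L * (L + 3) ≤ 1 := by
  have hL' : (3 : ℝ) ≤ L := by exact_mod_cast hL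
  have h := loss_le (by omega : 2 ≤ L)
  rw [le_div_iff₀ (by positivity)] at h
  have h0 := loss_nonneg (by omega : 2 ≤ L)
  have : loss L * (L + 3) ≤ loss L * (L : ℝ) ^ 2 :=
    mul_le_mul_of_nonneg_left (by nlinarith) h0
  linarith

theorem guarantee_le_concentratedBound_of_three {L : ℕ} (hL : 3 ≤ L) {x : ℝ}
    (hx : x ∈ Set.Icc (0 : ℝ) 1) : guarantee L ≤ concentratedBound L x := by
  have hL' : (3 : ℝ) ≤ L := by exact_mod_cast hL
  have hz : 1 - x ∈ Set.Icc (0 : ℝ) 1 := ⟨by linarith [hx.2], by linarith [hx.1]⟩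
  have hgrow := attenuation_growth hL hz
  rw [sub_sub_cancel] at hgrow
  rw [guarantee_eq_mul_integral hL, concentratedBound_eq]
  have hI := integral_mul_one_sub_pow (1 - loss L) (L - 1)
  rw [sub_sub_cancel, Nat.cast_sub (by omega)] at hI
  push_cast at hI
  have hc0 := loss_nonneg (by omega : 2 ≤ L)
  have hc := loss_mul_le hL
  have hc1 : loss L ≤ 1 / 6 := by nlinarith
  have hF0 := blocking_nonneg (c := loss L) (by linarith) hz
  have hb := (attenuation_mem L (x := 1) ⟨zero_le_one, le_rfl⟩).1
  have hI0 : 0 ≤ ∫ y in (0 : ℝ)..1, (1 - y * (1 - loss L)) ^ (L - 1) :=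
    intervalIntegral.integral_nonneg zero_le_one fun y hy =>
      pow_nonneg (by nlinarith [hy.1, hy.2]) _
  have hp := pow_nonneg hc0 (L - 1 + 1)
  have hle : (1 - loss L) * (L + 1) * (∫ y in (0 : ℝ)..1, y * (1 - y * (1 - loss L)) ^ (L - 1)) ≤
      ∫ y in (0 : ℝ)..1, (1 - y * (1 - loss L)) ^ (L - 1) := by
    have e : (L : ℝ) - 1 + 2 = L + 1 := by ring
    rw [e] at hI
    linarith
  clear hI hp
  generalize ∫ y in (0 : ℝ)..1, (1 - y * (1 - loss L)) ^ (L - 1) = I₀ at *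
  generalize ∫ y in (0 : ℝ)..1, y * (1 - y * (1 - loss L)) ^ (L - 1) = I₁ at *
  generalize 1 - x = z at *
  generalize loss L = c at *
  have hβ : 0 < (1 - c) * (L + 1) := mul_pos (by linarith) (by linarith)
  have h1 : I₁ ≤ I₀ / ((1 - c) * (L + 1)) := by rw [le_div_iff₀ hβ]; linarith
  have hFz := blocking_le (m := z) hc0
  have h2 : I₀ * (1 - blocking c z / ((1 - c) * (L + 1))) ≤ I₀ - blocking c z * I₁ := by
    have := mul_le_mul_of_nonneg_left h1 hF0
    have e : blocking c z * (I₀ / ((1 - c) * (L + 1))) =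
      I₀ * (blocking c z / ((1 - c) * (L + 1))) := by ring
    linarith
  have h3 : 0 ≤ 1 - blocking c z / ((1 - c) * (L + 1)) := by
    rw [sub_nonneg, div_le_one hβ]
    nlinarith [hz.2]
  -- With z = 1 - x, the gain 1 + z/L in b compensates the loss from the partial batch: after
  -- clearing denominators the difference is z(1 - z)(1 - cL - c(1 + z)).
  have h4 : 1 ≤ (1 + z / L) * (1 - blocking c z / ((1 - c) * (L + 1))) := by
    have e : (1 + z / L) * (1 - blocking c z / ((1 - c) * (L + 1))) =
      ((L + z) * ((1 - c) * (L + 1) - blocking c z)) / (L * ((1 - c) * (L + 1))) := by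
      have : (1 - c) ≠ 0 := by linarith
      field_simp
    rw [e, le_div_iff₀ (mul_pos (by linarith) hβ), blocking]
    have h5 : 0 ≤ z * ((1 - z) * (1 - c * L - c * (1 + z))) := by
      refine mul_nonneg hz.1 (mul_nonneg (by linarith [hz.2]) ?_)
      nlinarith [hz.2]
    linarith
  calc attenuation L 1 * I₀
      ≤ attenuation L 1 * I₀ * ((1 + z / L) * (1 - blocking c z / ((1 - c) * (L + 1)))) :=
        le_mul_of_one_le_right (mul_nonneg hb hI0) h4
    _ = (attenuation L 1 * (1 + z / L)) * (I₀ * (1 - blocking c z / ((1 - c) * (L + 1)))) := by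
        ring
    _ ≤ attenuation L x * (I₀ - blocking c z * I₁) := by
        refine mul_le_mul hgrow h2 (mul_nonneg hI0 h3) (attenuation_mem L hx).1

theorem one_div_lt_guarantee_of_three {L : ℕ} (hL : 3 ≤ L) :
    1 / (1 + (L : ℝ)) < guarantee L := by
  have hL' : (3 : ℝ) ≤ L := by exact_mod_cast hL
  have h' : Real.exp 1 < Real.exp L := Real.exp_lt_exp.2 (by linarith)
  rw [guarantee_eq hL, div_lt_div_iff₀ (by linarith) (mul_pos (by linarith) (by linarith)),
    one_mul]
  have he := Real.exp_one_gt_d9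
  have he' := Real.exp_one_lt_d9
  have hw : Real.exp (1 / (L : ℝ)) ≤ 1.7 := by
    have h1 : Real.exp (1 / (L : ℝ)) ≤ Real.exp (1 / 2) :=
      Real.exp_le_exp.2 (one_div_le_one_div_of_le (by norm_num) (by linarith))
    have h2 : Real.exp (1 / 2) ^ 2 = Real.exp 1 := by rw [← Real.exp_nat_mul]; norm_num
    nlinarith [Real.exp_pos (1 / 2)]
  have hw0 := Real.exp_pos (1 / (L : ℝ))
  have hc0 := loss_nonneg (by omega : 2 ≤ L)
  have hc1 : loss L ≤ 1 / 6 := by nlinarith [loss_mul_le hL]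
  have hcE : loss L ^ L * Real.exp L ≤ 1 / 2 := by
    have e : Real.exp L = Real.exp 1 ^ L := by rw [← Real.exp_nat_mul, mul_one]
    rw [e, ← mul_pow]
    have h1 : loss L * Real.exp 1 ≤ 1 / 2 := by nlinarith
    have h0 : 0 ≤ loss L * Real.exp 1 := by positivity
    calc (loss L * Real.exp 1) ^ L ≤ (loss L * Real.exp 1) ^ 1 :=
          pow_le_pow_of_le_one h0 (by linarith) (by omega)
      _ ≤ 1 / 2 := by rwa [pow_one]
  have hcw : 0 ≤ loss L ^ L * Real.exp (1 / (L : ℝ)) := by positivity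
  -- What is left is e - e^(1/L) > c^L (e^L - e^(1/L)): the left side exceeds 1, the right side is
  -- at most 1/2.
  refine mul_lt_mul_of_pos_right ?_ (by linarith)
  nlinarith

theorem exp_half_sq : Real.exp (1 / 2) ^ 2 = Real.exp 1 := by
  rw [← Real.exp_nat_mul]; norm_num

theorem exp_half_bounds : 1.6487 < Real.exp (1 / 2) ∧ Real.exp (1 / 2) < 1.6488 := by
  have h := exp_half_sq
  have he := Real.exp_one_gt_d9
  have he' := Real.exp_one_lt_d9
  have h0 := Real.exp_pos (1 / 2)
  constructor <;> nlinarith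

theorem loss_two : loss 2 =
    1 / 4 - 3 / 4 / (Real.exp (1 / 2) + Real.exp (1 / 2) ^ 2 + Real.exp (1 / 2) ^ 3) := by
  have h4 : Real.exp 2 = Real.exp (1 / 2) ^ 4 := by rw [← Real.exp_nat_mul]; norm_num
  have h0 := exp_half_bounds.1
  rw [loss, attenuation_eq_exp le_rfl (one_div_mem le_rfl)]
  push_cast
  rw [h4]
  generalize Real.exp (1 / 2) = w at *
  have h1 : w ^ 4 - w = w * ((w - 1) * (w ^ 2 + w + 1)) := by ring
  have h2 : w + w ^ 2 + w ^ 3 = w * (w ^ 2 + w + 1) := by ring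
  have h3 : w - 1 ≠ 0 := by linarith
  have h4 : w ≠ 0 := by linarith
  have h5 : w ^ 2 + w + 1 ≠ 0 := by positivity
  rw [h1, h2]
  field_simp
  ring

theorem loss_two_bounds : 0.16523 < loss 2 ∧ loss 2 < 0.16525 := by
  obtain ⟨h1, h2⟩ := exp_half_bounds
  have h := exp_half_sq
  have he := Real.exp_one_gt_d9
  have he' := Real.exp_one_lt_d9
  rw [loss_two]
  have h3 : Real.exp (1 / 2) ^ 3 = Real.exp (1 / 2) * Real.exp 1 := by rw [pow_succ, h, mul_comm]
  rw [h3, h]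
  generalize Real.exp (1 / 2) = w at *
  generalize Real.exp 1 = e at *
  have b1 : 8.848 < w + e + w * e := by nlinarith
  have b2 : w + e + w * e < 8.8492 := by nlinarith
  have h0 : 0 < w + e + w * e := by linarith
  constructor
  · rw [lt_sub_comm, div_lt_iff₀ h0]; linarith
  · rw [sub_lt_comm, lt_div_iff₀ h0]; linarith

theorem guarantee_two : guarantee 2 = (1 + loss 2 + loss 2 ^ 2) / 3 := by
  have h1 : Real.exp 1 = Real.exp (1 / 2) ^ 2 := exp_half_sq.symm
  have h3 : Real.exp (3 / 2) = Real.exp (1 / 2) ^ 3 := by rw [← Real.exp_nat_mul]; norm_num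
  have h4 : Real.exp 2 = Real.exp (1 / 2) ^ 4 := by rw [← Real.exp_nat_mul]; norm_num
  have h5 : Real.exp (5 / 2) = Real.exp (1 / 2) ^ 5 := by rw [← Real.exp_nat_mul]; norm_num
  have h6 : Real.exp 3 = Real.exp (1 / 2) ^ 6 := by rw [← Real.exp_nat_mul]; norm_num
  rw [guarantee, if_pos rfl, loss_two, h1, h3, h4, h5, h6]
  have h0 := exp_half_bounds.1
  generalize Real.exp (1 / 2) = w at *
  have h7 : w + w ^ 2 + w ^ 3 = w * (1 + w + w ^ 2) := by ring
  rw [h7]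
  have h8 : (1 + w + w ^ 2) ≠ 0 := by positivity
  have h9 : w ≠ 0 := by positivity
  field_simp
  ring

theorem guarantee_two_bounds : 0.397 ≤ guarantee 2 ∧ guarantee 2 < 0.398 := by
  obtain ⟨h1, h2⟩ := loss_two_bounds
  rw [guarantee_two]
  constructor <;> nlinarith

theorem concentratedBound_two (x : ℝ) : concentratedBound 2 x = attenuation 2 x *
    ((1 + loss 2) / 2 - blocking (loss 2) (1 - x) * ((1 + 2 * loss 2) / 6)) := by
  have h1 := integral_one_sub_pow (1 - loss 2) 1
  have h2 := integral_mul_one_sub_pow (1 - loss 2) 1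
  obtain ⟨hc1, hc2⟩ := loss_two_bounds
  rw [concentratedBound_eq]
  norm_num only [Nat.reduceSub] at h1 h2 ⊢
  generalize ∫ y in (0 : ℝ)..1, (1 - y * (1 - loss 2)) ^ 1 = I₀ at *
  generalize ∫ y in (0 : ℝ)..1, y * (1 - y * (1 - loss 2)) ^ 1 = I₁ at *
  generalize loss 2 = c at *
  have hβ : 1 - c ≠ 0 := by linarith
  have e1 : I₀ = (1 + c) / 2 := mul_left_cancel₀ hβ (by linarith)
  have e2 : I₁ = (1 + 2 * c) / 6 := mul_left_cancel₀ hβ (by rw [e1] at h2; linarith)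
  rw [e1, e2]

/-- Equality holds at x = 0. With the denominator cleared and e^x replaced by its Taylor polynomial
of degree 5, the difference is a polynomial without constant term. -/
theorem guarantee_le_concentratedBound_two {x : ℝ} (hx : x ∈ Set.Icc (0 : ℝ) 1) :
    guarantee 2 ≤ concentratedBound 2 x := by
  obtain ⟨hc1, hc2⟩ := loss_two_bounds
  rw [guarantee_two, concentratedBound_two, attenuation_eq_exp le_rfl hx]
  push_cast
  have hQ : Real.exp 2 = Real.exp 1 ^ 2 := by rw [← Real.exp_nat_mul]; norm_num
  have he := Real.exp_one_gt_d9
  have he' := Real.exp_one_lt_d9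
  have hQ1 : 7.38905 < Real.exp 2 := by rw [hQ]; nlinarith
  have hQ2 : Real.exp 2 < 7.38906 := by rw [hQ]; nlinarith
  have hlt : Real.exp x < Real.exp 2 := Real.exp_lt_exp.2 (by linarith [hx.2])
  have hexp := Real.sum_le_exp_of_nonneg hx.1 6
  norm_num [Finset.sum_range_succ, Nat.factorial] at hexp
  rw [blocking, div_mul_eq_mul_div, le_div_iff₀ (by linarith)]
  generalize Real.exp x = X at *
  generalize Real.exp 2 = Q at *
  generalize loss 2 = c at *
  have hx0 := hx.1
  have hx1 := hx.2
  clear hx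
  have hG : 0 < 1 + c + c ^ 2 := by positivity
  have h1 := mul_le_mul_of_nonneg_left hexp hG.le
  have hR1 : 6.38905 < Q - 1 := by linarith
  have hR2 : Q - 1 < 6.38906 := by linarith
  have hcc1 : 0.0273 < c ^ 2 := by nlinarith
  have hcc2 : c ^ 2 < 0.02731 := by nlinarith
  -- Lower bounds for the coefficients of x, ..., x⁵ in six times the difference.
  have A₁ : 0.913 ≤ 2 * ((Q - 1) * (-c - 5 * c ^ 2)) + 4 * (1 + c + c ^ 2) := by nlinarith
  have A₂ : -0.498 ≤ (Q - 1) * (2 * c - 1 + 8 * c ^ 2) + 2 * (1 + c + c ^ 2) := by nlinarith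
  have A₃ : -0.611 ≤ (Q - 1) * (-c - 2 * c ^ 2) + 4 / 6 * (1 + c + c ^ 2) := by nlinarith
  have A₄ : 0.198 ≤ (1 + c + c ^ 2) / 6 := by linarith
  have A₅ : 0.039 ≤ (1 + c + c ^ 2) / 30 := by linarith
  have B₁ := mul_le_mul_of_nonneg_right A₁ hx0
  have B₂ := mul_le_mul_of_nonneg_right A₂ (pow_nonneg hx0 2)
  have B₃ := mul_le_mul_of_nonneg_right A₃ (pow_nonneg hx0 3)
  have B₄ := mul_le_mul_of_nonneg_right A₄ (pow_nonneg hx0 4)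
  have B₅ := mul_le_mul_of_nonneg_right A₅ (pow_nonneg hx0 5)
  have hpoly : 0 ≤ x * (0.913 - 0.498 * x - 0.611 * x ^ 2 + 0.198 * x ^ 3 + 0.039 * x ^ 4) := by
    -- Division by 1 - x; the remainder 0.041 is the value at 1.
    have e : 0.913 - 0.498 * x - 0.611 * x ^ 2 + 0.198 * x ^ 3 + 0.039 * x ^ 4 = 0.041 + (1 - x) *
        (0.498 + 0.611 * (1 + x) - 0.198 * (1 + x + x ^ 2)
          - 0.039 * (1 + x + x ^ 2 + x ^ 3)) := by ring
    have h2 : x ^ 2 ≤ 1 := pow_le_one₀ hx0 hx1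
    have h3 : x ^ 3 ≤ 1 := pow_le_one₀ hx0 hx1
    rw [e]
    exact mul_nonneg hx0 (add_nonneg (by norm_num) (mul_nonneg (by linarith) (by linarith)))
  linarith

/-! ### Random orders and uniform arrival times -/

/-- In a uniformly random order, `t` comes after all the elements of `A` with probability
`1 / (|A| + 1)`. -/
theorem card_perm_forall_lt {T : ℕ} (t : Fin T) (A : Finset (Fin T)) (ht : t ∉ A) :
    (A.card + 1) * (Finset.univ.filter
      fun σ : Equiv.Perm (Fin T) => ∀ a ∈ A, σ.symm a < σ.symm t).card = T.factorial := by
  classical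
  set C := insert t A with hC
  let last (a : Fin T) : Finset (Equiv.Perm (Fin T)) :=
    Finset.univ.filter fun σ => ∀ b ∈ C, b ≠ a → σ.symm b < σ.symm a
  have htC : t ∈ C := Finset.mem_insert_self _ _
  have hlast : last t = Finset.univ.filter
      fun σ : Equiv.Perm (Fin T) => ∀ a ∈ A, σ.symm a < σ.symm t := by
    refine Finset.filter_congr fun σ _ => ⟨fun h a ha => ?_, fun h b hb hbt => ?_⟩
    · exact h a (Finset.mem_insert_of_mem ha) (fun e => ht (e ▸ ha))
    · exact h b ((Finset.mem_insert.1 hb).resolve_left hbt)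
  -- By symmetry every element of C is equally often the last: exchanging a and t permutes C and
  -- carries one event to the other.
  have hcard : ∀ a ∈ C, (last a).card = (last t).card := by
    intro a ha
    have hswap : ∀ b ∈ C, Equiv.swap a t b ∈ C := by
      intro b hb
      by_cases h1 : b = a
      · rw [h1, Equiv.swap_apply_left]; exact htC
      · by_cases h2 : b = t
        · rw [h2, Equiv.swap_apply_right]; exact ha
        · rw [Equiv.swap_apply_of_ne_of_ne h1 h2]; exact hb
    refine Finset.card_bij' (fun σ _ => σ.trans (Equiv.swap a t))
      (fun σ _ => σ.trans (Equiv.swap a t)) ?_ ?_ ?_ ?_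
    · intro σ hσ
      simp only [last, Finset.mem_filter, Finset.mem_univ, true_and, Equiv.symm_trans_apply,
        Equiv.symm_swap, Equiv.swap_apply_right] at hσ ⊢
      intro b hb hbt
      refine hσ _ (hswap b hb) fun e => hbt ?_
      exact (Equiv.swap a t).injective (e.trans (Equiv.swap_apply_right a t).symm)
    · intro σ hσ
      simp only [last, Finset.mem_filter, Finset.mem_univ, true_and, Equiv.symm_trans_apply,
        Equiv.symm_swap, Equiv.swap_apply_left] at hσ ⊢
      intro b hb hba
      refine hσ _ (hswap b hb) fun e => hba ?_
      exact (Equiv.swap a t).injective (e.trans (Equiv.swap_apply_left a t).symm)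
    · intro σ _
      ext; simp
    · intro σ _
      ext; simp
  have hunion : (Finset.univ : Finset (Equiv.Perm (Fin T))) = C.biUnion last := by
    refine (Finset.eq_univ_iff_forall.2 fun σ => ?_).symm
    obtain ⟨a, ha, hmax⟩ := Finset.exists_max_image C (fun b => σ.symm b) ⟨t, htC⟩
    refine Finset.mem_biUnion.2 ⟨a, ha, ?_⟩
    simp only [last, Finset.mem_filter, Finset.mem_univ, true_and]
    exact fun b hb hba => lt_of_le_of_ne (hmax b hb) fun e => hba (σ.symm.injective e)
  have hdisj : (C : Set (Fin T)).PairwiseDisjoint last := by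
    intro a ha b hb hab
    refine Finset.disjoint_left.2 fun σ h1 h2 => ?_
    simp only [last, Finset.mem_filter, Finset.mem_univ, true_and] at h1 h2
    exact lt_asymm (h1 b hb hab.symm) (h2 a ha hab)
  have hsum : Fintype.card (Equiv.Perm (Fin T)) = ∑ a ∈ C, (last a).card := by
    rw [← Finset.card_univ, hunion, Finset.card_biUnion hdisj]
  rw [Fintype.card_perm, Fintype.card_fin, Finset.sum_congr rfl hcard, Finset.sum_const,
    smul_eq_mul, hC, Finset.card_insert_of_notMem ht] at hsum
  rw [← hlast, hsum]

/-- Averaging over uniformly random orders amounts to averaging over an arrival time that is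
uniform on `[0, 1]`. -/
theorem sum_perm_prod_before {T : ℕ} (t : Fin T) (q : Fin T → ℝ) :
    ∑ σ : Equiv.Perm (Fin T), ∏ s with σ.symm s < σ.symm t, (1 - q s) =
      T.factorial * ∫ y in (0 : ℝ)..1, ∏ s ∈ Finset.univ.erase t, (1 - y * q s) := by
  classical
  -- Both sides are expanded over subsets A of the other batches. A precedes t with probability
  -- 1/(|A| + 1), which is the integral of y^|A|.
  have hL : ∀ σ : Equiv.Perm (Fin T), ∏ s with σ.symm s < σ.symm t, (1 - q s) =
      ∑ A ∈ (Finset.univ.erase t).powerset,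
        if ∀ a ∈ A, σ.symm a < σ.symm t then ∏ s ∈ A, (-q s) else 0 := by
    intro σ
    simp only [sub_eq_add_neg, Finset.prod_one_add]
    rw [← Finset.sum_filter]
    refine Finset.sum_congr ?_ fun _ _ => rfl
    ext A
    simp only [Finset.mem_powerset, Finset.mem_filter, Finset.subset_iff, Finset.mem_univ,
      true_and, Finset.mem_erase, and_true]
    exact ⟨fun h => ⟨fun a ha e => lt_irrefl _ (e ▸ h ha), fun _ ha => h ha⟩, fun h _ ha => h.2 ha⟩
  have hR : ∀ y : ℝ, ∏ s ∈ Finset.univ.erase t, (1 - y * q s) =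
      ∑ A ∈ (Finset.univ.erase t).powerset, y ^ A.card * ∏ s ∈ A, (-q s) := by
    intro y
    simp only [sub_eq_add_neg, Finset.prod_one_add]
    refine Finset.sum_congr rfl fun A _ => ?_
    rw [← Finset.prod_const, ← Finset.prod_mul_distrib]
    exact Finset.prod_congr rfl fun s _ => by ring
  simp only [hL, hR]
  rw [Finset.sum_comm, intervalIntegral.integral_finsetSum
    (fun A _ => by apply Continuous.intervalIntegrable; fun_prop), Finset.mul_sum]
  refine Finset.sum_congr rfl fun A hA => ?_
  have htA : t ∉ A := fun h => by simpa using Finset.mem_powerset.1 hA h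
  have hc := card_perm_forall_lt t A htA
  rw [← Finset.sum_filter, Finset.sum_const, intervalIntegral.integral_mul_const, integral_pow,
    ← hc, nsmul_eq_mul]
  have : (A.card : ℝ) + 1 ≠ 0 := by positivity
  push_cast
  simp only [one_pow, ne_eq, Nat.add_eq_zero_iff, one_ne_zero, and_false, not_false_eq_true,
    zero_pow, sub_zero]
  field_simp

/-! ### Lower bounds for probabilities in composed laws -/

theorem mul_toOuterMeasure_le_bind {α β : Type*} (p : PMF α) (f : α → PMF β) (A : Set α)
    (B : Set β) (r : ℝ≥0∞) (h : ∀ a ∈ A, r ≤ (f a).toOuterMeasure B) :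
    p.toOuterMeasure A * r ≤ (p.bind f).toOuterMeasure B := by
  classical
  rw [PMF.toOuterMeasure_bind_apply, PMF.toOuterMeasure_apply, ← ENNReal.tsum_mul_right]
  refine ENNReal.tsum_le_tsum fun a => ?_
  by_cases ha : a ∈ A
  · rw [Set.indicator_of_mem ha]
    exact mul_le_mul_right (h a ha) _
  · rw [Set.indicator_of_notMem ha, zero_mul]
    exact zero_le

theorem sum_le_toOuterMeasure_bind {α β : Type*} [Fintype α] (p : PMF α) (f : α → PMF β)
    (B : Set β) (w g : α → ℝ) (hw : ∀ a, p a = ENNReal.ofReal (w a)) (hw0 : ∀ a, 0 ≤ w a)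
    (hg0 : ∀ a, 0 ≤ g a) (h : ∀ a, ENNReal.ofReal (g a) ≤ (f a).toOuterMeasure B) :
    ENNReal.ofReal (∑ a, w a * g a) ≤ (p.bind f).toOuterMeasure B := by
  rw [PMF.toOuterMeasure_bind_apply, tsum_fintype,
    ENNReal.ofReal_sum_of_nonneg fun a _ => mul_nonneg (hw0 a) (hg0 a)]
  refine Finset.sum_le_sum fun a _ => ?_
  rw [ENNReal.ofReal_mul (hw0 a), hw a]
  exact mul_le_mul_right (h a) _

theorem apply_le_toOuterMeasure {α : Type*} (p : PMF α) {B : Set α} {a : α} (ha : a ∈ B) :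
    p a ≤ p.toOuterMeasure B := by
  rw [← PMF.toOuterMeasure_apply_singleton]
  exact p.toOuterMeasure.mono (Set.singleton_subset_iff.2 ha)

theorem toOuterMeasure_ne_top {α : Type*} (p : PMF α) (B : Set α) : p.toOuterMeasure B ≠ ⊤ := by
  have h : p.toOuterMeasure B ≤ p.toOuterMeasure Set.univ :=
    p.toOuterMeasure.mono (Set.subset_univ B)
  have h1 : p.toOuterMeasure Set.univ = 1 :=
    (p.toOuterMeasure_apply_eq_one_iff Set.univ).2 (Set.subset_univ _)
  rw [h1] at h
  exact (h.trans_lt ENNReal.one_lt_top).ne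

theorem le_toOuterMeasure_map_coin {β : Type*} (p : unitInterval) (f : Bool → β) (B : Set β)
    (d : Bool) (hd : f d ∈ B) : ENNReal.ofReal (if d then (p : ℝ) else 1 - p) ≤
      ((coin p).map f).toOuterMeasure B := by
  rw [PMF.toOuterMeasure_map_apply]
  exact apply_le_toOuterMeasure (coin p) (B := f ⁻¹' B) hd

theorem toOuterMeasure_eq_one_of_forall {α : Type*} (p : PMF α) (B : Set α) (h : ∀ a, a ∈ B) :
    p.toOuterMeasure B = 1 :=
  (p.toOuterMeasure_apply_eq_one_iff B).2 fun a _ => h a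

theorem toOuterMeasure_pure_of_mem {α : Type*} {B : Set α} {a : α} (ha : a ∈ B) :
    (PMF.pure a).toOuterMeasure B = 1 := by
  classical
  rw [PMF.toOuterMeasure_pure_apply, if_pos ha]

theorem accepted_cons_subset {N : Type v} {T : ℕ} (r : Round N T) (h : History N T) :
    accepted h ⊆ accepted (r :: h) :=
  fun _ ⟨r', hr', e⟩ => ⟨r', List.mem_cons_of_mem _ hr', e⟩

theorem mem_accepted_cons {N : Type v} {T : ℕ} (r : Round N T) (h : History N T) (j : N) :
    j ∈ accepted (r :: h) ↔ (r.active = some j ∧ r.accepted = true) ∨ j ∈ accepted h := by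
  simp [accepted]

/-! ### The scheme on a single input -/

namespace Input

variable {M : Type u} {N : Type v} [Fintype N] {T L : ℕ} (I : Input M N T L)

/-- Two products conflict if their bundles meet. -/
def Conflict (j' j : N) : Prop := ¬ Disjoint (I.bundle j') (I.bundle j)

theorem feasible_cons_of_not_accepted {h : History N T} {j : N} (hf : I.Feasible h j)
    {r : Round N T} (hr : r.accepted = false) : I.Feasible (r :: h) j := by
  intro j' hj'
  rcases (mem_accepted_cons r h j').1 hj' with ⟨_, h2⟩ | h2
  · simp [hr] at h2
  · exact hf j' h2

theorem feasible_cons_of_not_conflict {h : History N T} {j k : N} (hf : I.Feasible h j)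
    {r : Round N T} (hr : r.active = some k) (hk : ¬ I.Conflict k j) : I.Feasible (r :: h) j := by
  intro j' hj'
  rcases (mem_accepted_cons r h j').1 hj' with ⟨h1, _⟩ | h2
  · rw [hr, Option.some.injEq] at h1
    subst h1
    exact (not_not.1 hk).symm
  · exact hf j' h2

/-- The acceptance probability of a feasible active product under the attenuate-greedy scheme. -/
def rate (j : N) : ℝ := attenuation L (I.localMass (I.batch j) j)

theorem rate_mem (j : N) : I.rate j ∈ Set.Icc (0 : ℝ) 1 :=
  attenuation_mem L (I.localMass_mem _ j)

open Classical in
/-- The probability that the active product of batch `s` conflicts with `j` and its coin shows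
heads. -/
def blockRate (j : N) (s : Fin T) : ℝ :=
  ∑ k with I.batch k = s ∧ I.Conflict k j, I.x k * I.rate k

/-- The attenuate-greedy policy for the input. -/
def greedy : Policy N T := attenuateGreedy L M N T I

/-- Treating every conflicting active product as if it were feasible only lowers the bound and makes
it independent of the history, so that it multiplies along a run. -/
theorem le_step_feasible {h : History N T} {j : N} (hf : I.Feasible h j) (s : Fin T) :
    ENNReal.ofReal (1 - I.blockRate j s) ≤
      (I.step I.greedy h s).toOuterMeasure {h' | I.Feasible h' j} := by
  classical
  have hsum : 1 - I.blockRate j s = ∑ o, I.activeProb s o *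
      (match o with
        | none => 1
        | some k => if I.Conflict k j then 1 - I.rate k else 1) := by
    have h1 := I.sum_activeProb s
    rw [Fintype.sum_option] at h1 ⊢
    have h2 : I.blockRate j s =
        ∑ k, I.activeProb s (some k) * (if I.Conflict k j then I.rate k else 0) := by
      rw [blockRate, Finset.sum_filter]
      refine Finset.sum_congr rfl fun k _ => ?_
      by_cases hk : I.batch k = s <;> by_cases hc : I.Conflict k j <;> simp [activeProb, hk, hc]
    have h3 : ∑ k, I.activeProb s (some k) * (if I.Conflict k j then 1 - I.rate k else 1) =
        (∑ k, I.activeProb s (some k)) - I.blockRate j s := by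
      rw [h2, ← Finset.sum_sub_distrib]
      refine Finset.sum_congr rfl fun k _ => ?_
      by_cases hc : I.Conflict k j
      · rw [if_pos hc, if_pos hc]; ring
      · rw [if_neg hc, if_neg hc]; ring
    dsimp only
    linarith
  rw [hsum, step]
  refine sum_le_toOuterMeasure_bind _ _ _ _ _ (fun o => rfl) (I.activeProb_nonneg s) ?_ ?_
  · rintro (_ | k)
    · exact zero_le_one
    · dsimp only
      split_ifs
      · linarith [(I.rate_mem k).2]
      · exact zero_le_one
  · rintro (_ | k)
    · rw [ENNReal.ofReal_one, toOuterMeasure_pure_of_mem]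
      exact I.feasible_cons_of_not_accepted hf rfl
    · dsimp only
      have hrej : I.Feasible (⟨s, some k, false⟩ :: h) j := I.feasible_cons_of_not_accepted hf rfl
      have hle : ENNReal.ofReal (if I.Conflict k j then 1 - I.rate k else 1) ≤ 1 := by
        rw [ENNReal.ofReal_le_one]
        split_ifs
        · linarith [(I.rate_mem k).1]
        · exact le_rfl
      by_cases hk : I.Feasible h k
      · rw [if_pos hk]
        by_cases hc : I.Conflict k j
        · rw [if_pos hc]
          exact le_toOuterMeasure_map_coin (I.greedy h k) _ _ false hrej
        · rw [PMF.toOuterMeasure_map_apply, toOuterMeasure_eq_one_of_forall]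
          · exact hle
          · exact fun d => I.feasible_cons_of_not_conflict hf rfl hc
      · rw [if_neg hk, toOuterMeasure_pure_of_mem]
        · exact hle
        · exact hrej

theorem le_step_accepted {h : History N T} {j : N} (hf : I.Feasible h j) :
    ENNReal.ofReal (I.x j * I.rate j) ≤
      (I.step I.greedy h (I.batch j)).toOuterMeasure {h' | j ∈ accepted h'} := by
  classical
  have hsum : I.x j * I.rate j =
      ∑ o, I.activeProb (I.batch j) o * (if o = some j then I.rate j else 0) := by
    simp [activeProb]
  rw [hsum, step]
  refine sum_le_toOuterMeasure_bind _ _ _ _ _ (fun o => rfl) (I.activeProb_nonneg _) ?_ ?_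
  · intro o
    split_ifs
    · exact (I.rate_mem j).1
    · exact le_rfl
  · intro o
    by_cases ho : o = some j
    · subst ho
      rw [if_pos rfl]
      dsimp only
      rw [if_pos hf]
      exact le_toOuterMeasure_map_coin (I.greedy h j) _ _ true
        ((mem_accepted_cons _ _ _).2 (Or.inl ⟨rfl, rfl⟩))
    · rw [if_neg ho, ENNReal.ofReal_zero]
      exact zero_le

theorem step_accepted_of_mem (π : Policy N T) {h : History N T} {j : N} (hj : j ∈ accepted h)
    (s : Fin T) : (I.step π h s).toOuterMeasure {h' | j ∈ accepted h'} = 1 := by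
  classical
  refine (PMF.toOuterMeasure_apply_eq_one_iff _ _).2 ?_
  intro h' hh'
  have hmem : ∀ r : Round N T, j ∈ accepted (r :: h) := fun r => accepted_cons_subset r h hj
  rw [step, PMF.mem_support_bind_iff] at hh'
  obtain ⟨o, _, ho⟩ := hh'
  rcases o with _ | k
  · rw [PMF.mem_support_pure_iff] at ho
    subst ho; exact hmem _
  · dsimp only at ho
    split_ifs at ho
    · rw [PMF.mem_support_map_iff] at ho
      obtain ⟨d, _, rfl⟩ := ho
      exact hmem _
    · rw [PMF.mem_support_pure_iff] at ho
      subst ho; exact hmem _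

theorem run_append_singleton (π : Policy N T) (l : List (Fin T)) (s : Fin T) :
    I.run π (l ++ [s]) = (I.run π l).bind fun h => I.step π h s := by
  simp [run, List.foldl_append]

theorem le_run_feasible (j : N) (l : List (Fin T)) :
    (l.map fun s => ENNReal.ofReal (1 - I.blockRate j s)).prod ≤
      (I.run I.greedy l).toOuterMeasure {h | I.Feasible h j} := by
  induction l using List.reverseRecOn with
  | nil =>
    rw [run, List.foldl_nil, toOuterMeasure_pure_of_mem]
    · simp
    · intro j' hj'
      simp [accepted] at hj'
  | append_singleton l s ih =>
    rw [run_append_singleton, List.map_append, List.prod_append]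
    simp only [List.map_cons, List.map_nil, List.prod_singleton]
    exact (mul_le_mul_left ih _).trans
      (mul_toOuterMeasure_le_bind _ _ _ _ _ fun h hh => I.le_step_feasible hh s)

theorem run_accepted_mono (π : Policy N T) (j : N) (l l' : List (Fin T)) :
    (I.run π l).toOuterMeasure {h | j ∈ accepted h} ≤
      (I.run π (l ++ l')).toOuterMeasure {h | j ∈ accepted h} := by
  induction l' using List.reverseRecOn with
  | nil => simp
  | append_singleton l' s ih =>
    rw [← List.append_assoc, run_append_singleton]
    refine ih.trans ?_
    have := mul_toOuterMeasure_le_bind (I.run π (l ++ l')) (fun h => I.step π h s)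
      {h | j ∈ accepted h} {h | j ∈ accepted h} 1
      fun h hh => (I.step_accepted_of_mem π hh s).ge
    rwa [mul_one] at this

theorem le_run_accepted (j : N) (l l' : List (Fin T)) :
    (l.map fun s => ENNReal.ofReal (1 - I.blockRate j s)).prod *
        ENNReal.ofReal (I.x j * I.rate j) ≤
      (I.run I.greedy (l ++ I.batch j :: l')).toOuterMeasure {h | j ∈ accepted h} := by
  have h := I.run_accepted_mono I.greedy j (l ++ [I.batch j]) l'
  rw [List.append_assoc, List.singleton_append] at h
  refine le_trans ?_ h
  rw [run_append_singleton]
  exact (mul_le_mul_left (I.le_run_feasible j l) _).trans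
    (mul_toOuterMeasure_le_bind _ _ _ _ _ fun h hh => I.le_step_accepted hh)

theorem blockRate_nonneg (j : N) (s : Fin T) : 0 ≤ I.blockRate j s :=
  Finset.sum_nonneg fun k _ => mul_nonneg (I.x_nonneg k) (I.rate_mem k).1

theorem blockRate_le_localMass (j : N) (s : Fin T) : I.blockRate j s ≤ I.localMass s j := by
  rw [blockRate, localMass]
  refine (Finset.sum_le_sum fun k _ =>
    mul_le_of_le_one_right (I.x_nonneg k) (I.rate_mem k).2).trans_eq ?_
  congr

theorem blockRate_le_one (j : N) (s : Fin T) : I.blockRate j s ≤ 1 :=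
  (I.blockRate_le_localMass j s).trans (I.localMass_mem s j).2

theorem le_run_perm (j : N) (σ : Equiv.Perm (Fin T)) :
    ENNReal.ofReal (I.x j * I.rate j *
        ∏ s with σ.symm s < σ.symm (I.batch j), (1 - I.blockRate j s)) ≤
      (I.run I.greedy (List.ofFn σ)).toOuterMeasure {h | j ∈ accepted h} := by
  set i := σ.symm (I.batch j) with hi
  have hsplit : List.ofFn σ =
      (List.ofFn σ).take i ++ I.batch j :: (List.ofFn σ).drop (i + 1) := by
    have hlen : (i : ℕ) < (List.ofFn σ).length := by simp
    conv_lhs => rw [← List.take_append_drop i (List.ofFn σ), List.drop_eq_getElem_cons hlen]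
    congr 2
    simp [hi]
  have hprod : (((List.ofFn σ).take i).map
        fun s => ENNReal.ofReal (1 - I.blockRate j s)).prod =
      ENNReal.ofReal (∏ s with σ.symm s < i, (1 - I.blockRate j s)) := by
    rw [List.map_take, List.map_ofFn, List.prod_take_ofFn,
      ENNReal.ofReal_prod_of_nonneg fun s _ => sub_nonneg.2 (I.blockRate_le_one j s)]
    refine Finset.prod_bij (fun a _ => σ a) ?_ ?_ ?_ ?_
    · intro a ha
      simpa using ha
    · exact fun a _ b _ e => σ.injective e
    · intro b hb
      exact ⟨σ.symm b, by simpa using hb, by simp⟩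
    · intro a _
      rfl
  have h := I.le_run_accepted j ((List.ofFn σ).take i) ((List.ofFn σ).drop (i + 1))
  rw [← hsplit, hprod, mul_comm, ← ENNReal.ofReal_mul
    (mul_nonneg (I.x_nonneg j) (I.rate_mem j).1)] at h
  exact h

theorem le_acceptProb (j : N) :
    I.x j * I.rate j *
        ∫ y in (0 : ℝ)..1, ∏ s ∈ Finset.univ.erase (I.batch j), (1 - y * I.blockRate j s) ≤
      I.acceptProb I.greedy j := by
  have hT : (0 : ℝ) < T.factorial := by exact_mod_cast T.factorial_pos
  have hrate := mul_nonneg (I.x_nonneg j) (I.rate_mem j).1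
  rw [acceptProb, ← ENNReal.ofReal_le_iff_le_toReal (toOuterMeasure_ne_top _ _), law]
  refine le_of_eq_of_le ?_ (sum_le_toOuterMeasure_bind _ _ _ (fun _ => (T.factorial : ℝ)⁻¹)
    (fun σ => I.x j * I.rate j *
      ∏ s with σ.symm s < σ.symm (I.batch j), (1 - I.blockRate j s)) ?_ ?_ ?_ ?_)
  · rw [← Finset.mul_sum, ← Finset.mul_sum, sum_perm_prod_before]
    congr 1
    field_simp
  · intro σ
    rw [PMF.uniformOfFintype_apply, Fintype.card_perm, Fintype.card_fin,
      ENNReal.ofReal_inv_of_pos hT, ENNReal.ofReal_natCast]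
  · exact fun _ => by positivity
  · exact fun σ => mul_nonneg hrate
      (Finset.prod_nonneg fun s _ => sub_nonneg.2 (I.blockRate_le_one j s))
  · exact fun σ => I.le_run_perm j σ

/-- Every conflicting product contains one of the at most L items of j, and each item carries mass
at most one. -/
theorem sum_localMass_le (j : N) : ∑ s, I.localMass s j ≤ L := by
  classical
  have h1 : ∑ s, I.localMass s j = ∑ k with ¬ Disjoint (I.bundle k) (I.bundle j), I.x k := by
    simp only [localMass, Finset.sum_filter]
    rw [Finset.sum_comm]
    refine Finset.sum_congr rfl fun k _ => ?_
    by_cases hk : Disjoint (I.bundle k) (I.bundle j) <;> simp [hk]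
  have h2 : ∑ k with ¬ Disjoint (I.bundle k) (I.bundle j), I.x k ≤
      ∑ i ∈ I.bundle j, ∑ k with i ∈ I.bundle k, I.x k := by
    simp only [Finset.sum_filter]
    rw [Finset.sum_comm]
    refine Finset.sum_le_sum fun k _ => ?_
    have hnn : ∀ i ∈ I.bundle j, 0 ≤ if i ∈ I.bundle k then I.x k else 0 := fun i _ => by
      split_ifs
      · exact I.x_nonneg k
      · exact le_rfl
    by_cases hk : Disjoint (I.bundle k) (I.bundle j)
    · rw [if_neg (not_not.2 hk)]
      exact Finset.sum_nonneg hnn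
    · rw [if_pos hk]
      obtain ⟨i, hi, hij⟩ := Finset.not_disjoint_iff.1 hk
      have := Finset.single_le_sum hnn hij
      rwa [if_pos hi] at this
  have h3 : ∑ i ∈ I.bundle j, ∑ k with i ∈ I.bundle k, I.x k ≤ ∑ i ∈ I.bundle j, (1 : ℝ) := by
    refine Finset.sum_le_sum fun i _ => ?_
    convert I.item_le_one i
  rw [Finset.sum_const, nsmul_eq_mul, mul_one] at h3
  have h4 : ((I.bundle j).card : ℝ) ≤ L := by exact_mod_cast I.bundle_card_le j
  linarith

/-- Conflicting products are grouped by an item shared with j; Jensen over the items of j then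
bounds the blocking rate. -/
theorem blockRate_le_blocking (hL : 2 ≤ L) (j : N) (s : Fin T) :
    I.blockRate j s ≤ blocking (loss L) (I.localMass s j) := by
  classical
  have hm := I.localMass_mem s j
  set C : Finset N := Finset.univ.filter fun k => I.batch k = s ∧ I.Conflict k j with hC
  have hCm : I.localMass s j = ∑ k ∈ C, I.x k := by
    rw [localMass, hC]; congr
  have hCb : I.blockRate j s = ∑ k ∈ C, I.x k * I.rate k := by
    rw [blockRate, hC]
  -- For a product without conflict the item is an arbitrary element of the bundle of j; it is never
  -- used.
  have hitem : ∀ k, ∃ i, I.Conflict k j → i ∈ I.bundle k ∧ i ∈ I.bundle j := by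
    intro k
    by_cases hk : I.Conflict k j
    · obtain ⟨i, hi, hij⟩ := Finset.not_disjoint_iff.1 hk
      exact ⟨i, fun _ => ⟨hi, hij⟩⟩
    · obtain ⟨i, _⟩ := I.bundle_nonempty j
      exact ⟨i, fun h => absurd h hk⟩
  choose item hitem using hitem
  have hmaps : ∀ k ∈ C, item k ∈ I.bundle j := fun k hk =>
    (hitem k (Finset.mem_filter.1 hk).2.2).2
  let μ (i : M) : ℝ := ∑ k ∈ C with item k = i, I.x k
  have hμ0 : ∀ i, 0 ≤ μ i := fun i => Finset.sum_nonneg fun k _ => I.x_nonneg k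
  have hμsum : ∑ i ∈ I.bundle j, μ i = I.localMass s j := by
    rw [hCm]; exact Finset.sum_fiberwise_of_maps_to hmaps _
  have hμ1 : ∀ i ∈ I.bundle j, μ i ∈ Set.Icc (0 : ℝ) 1 := fun i hi =>
    ⟨hμ0 i, (Finset.single_le_sum (fun i _ => hμ0 i) hi).trans (hμsum.trans_le hm.2)⟩
  -- All products charged to the item of k contain it and lie in the batch of k, so the local mass
  -- of k is at least μ (item k).
  have hrate : ∀ k ∈ C, I.rate k ≤ attenuation L (μ (item k)) := by
    intro k hk
    obtain ⟨-, hbk, hck⟩ := Finset.mem_filter.1 hk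
    refine antitoneOn_attenuation hL (hμ1 _ (hmaps k hk)) (I.localMass_mem _ k) ?_
    rw [localMass]
    refine Finset.sum_le_sum_of_subset_of_nonneg (fun l hl => ?_) fun l _ _ => I.x_nonneg l
    obtain ⟨hlC, hlk⟩ := Finset.mem_filter.1 hl
    obtain ⟨-, hbl, hcl⟩ := Finset.mem_filter.1 hlC
    refine Finset.mem_filter.2 ⟨Finset.mem_univ _, hbl.trans hbk.symm, ?_⟩
    exact Finset.not_disjoint_iff.2 ⟨item k, hlk ▸ (hitem l hcl).1, (hitem k hck).1⟩
  have h1 : I.blockRate j s ≤ ∑ i ∈ I.bundle j, μ i * attenuation L (μ i) := by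
    rw [hCb, ← Finset.sum_fiberwise_of_maps_to hmaps]
    refine Finset.sum_le_sum fun i _ => ?_
    simp only [μ]
    rw [Finset.sum_mul]
    refine Finset.sum_le_sum fun k hk => ?_
    obtain ⟨hkC, rfl⟩ := Finset.mem_filter.1 hk
    exact mul_le_mul_of_nonneg_left (hrate k hkC) (I.x_nonneg k)
  set n : ℝ := ((I.bundle j).card : ℝ) with hn
  have hn1 : 1 ≤ n := by
    rw [hn]; exact_mod_cast (I.bundle_nonempty j).card_pos
  have hnL : n ≤ L := by
    rw [hn]; exact_mod_cast I.bundle_card_le j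
  have hL0 : (0 : ℝ) < L := by linarith
  have hjensen := (concaveOn_mul_attenuation hL).le_map_sum (t := I.bundle j)
    (w := fun _ => n⁻¹) (p := μ) (fun _ _ => by positivity)
    (by rw [Finset.sum_const, nsmul_eq_mul, mul_inv_cancel₀ (by linarith)]) hμ1
  simp only [smul_eq_mul, ← Finset.mul_sum, hμsum] at hjensen
  have h2 : ∑ i ∈ I.bundle j, μ i * attenuation L (μ i) ≤
      I.localMass s j * attenuation L (n⁻¹ * I.localMass s j) := by
    rw [mul_assoc] at hjensen
    exact le_of_mul_le_mul_left hjensen (by positivity)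
  -- A bundle with fewer than L items spreads the mass less thinly, which means stronger
  -- attenuation; n = L is the worst case.
  have h3 : attenuation L (n⁻¹ * I.localMass s j) ≤ attenuation L (I.localMass s j / L) := by
    have hle : I.localMass s j / L ≤ n⁻¹ * I.localMass s j := by
      rw [div_eq_inv_mul]
      exact mul_le_mul_of_nonneg_right (inv_anti₀ (by linarith) hnL) hm.1
    have hle' : n⁻¹ * I.localMass s j ≤ 1 := mul_le_one₀ (inv_le_one_of_one_le₀ hn1) hm.1 hm.2
    have h0 : 0 ≤ I.localMass s j / L := div_nonneg hm.1 hL0.le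
    exact antitoneOn_attenuation hL ⟨h0, hle.trans hle'⟩ ⟨h0.trans hle, hle'⟩ hle
  have h4 := mul_le_mul_of_nonneg_left (h3.trans (attenuation_div_le hL hm)) hm.1
  rw [blocking]
  linarith

end Input

/-! ### Assembling the guarantee -/

theorem loss_mul_add_three_le {L : ℕ} (hL : 2 ≤ L) : loss L * (L + 3) ≤ 1 := by
  rcases hL.eq_or_lt with rfl | h
  · have := loss_two_bounds.2
    push_cast
    linarith
  · exact loss_mul_le h

theorem guarantee_le_concentratedBound {L : ℕ} (hL : 2 ≤ L) {x : ℝ}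
    (hx : x ∈ Set.Icc (0 : ℝ) 1) : guarantee L ≤ concentratedBound L x := by
  rcases hL.eq_or_lt with rfl | h
  · exact guarantee_le_concentratedBound_two hx
  · exact guarantee_le_concentratedBound_of_three h hx

theorem one_div_lt_guarantee {L : ℕ} (hL : 2 ≤ L) : 1 / (1 + (L : ℝ)) < guarantee L := by
  rcases hL.eq_or_lt with rfl | h
  · have := guarantee_two_bounds.1
    push_cast
    norm_num at this ⊢
    linarith
  · exact one_div_lt_guarantee_of_three h

theorem isSelectable_attenuateGreedy {L : ℕ} (hL : 2 ≤ L) :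
    IsSelectable.{u, v} (guarantee L) (attenuateGreedy.{u, v} L) := by
  intro M N _ T I j
  refine le_trans ?_ (I.le_acceptProb j)
  set t := I.batch j with ht
  have hx := I.localMass_mem t j
  have hc := loss_nonneg hL
  have hcL := loss_mul_add_three_le hL
  have hsum := I.sum_localMass_le j
  rw [← Finset.sum_erase_add _ _ (Finset.mem_univ t)] at hsum
  -- The pouring starts with no full batch and an empty partial batch, whose factors are 1.
  have hconc := integral_concentrated_le (by omega : 1 ≤ L) hc hcL hx (Finset.univ.erase t)
    (fun s => I.localMass s j) (fun s _ => I.localMass_mem s j) 0 0 ⟨le_rfl, zero_le_one⟩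
    (by push_cast; linarith)
  have hmono : ∫ y in (0 : ℝ)..1, (1 - y * blocking (loss L) 1) ^ 0 *
        (1 - y * blocking (loss L) 0) * ∏ s ∈ Finset.univ.erase t,
          (1 - y * blocking (loss L) (I.localMass s j)) ≤
      ∫ y in (0 : ℝ)..1, ∏ s ∈ Finset.univ.erase t, (1 - y * I.blockRate j s) := by
    refine intervalIntegral.integral_mono_on zero_le_one
      (by apply Continuous.intervalIntegrable; fun_prop)
      (by apply Continuous.intervalIntegrable; fun_prop) ?_
    intro y hy
    have h0 : blocking (loss L) 0 = 0 := by simp [blocking]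
    rw [h0, pow_zero, mul_zero, sub_zero, one_mul, one_mul]
    refine Finset.prod_le_prod (fun s _ => ?_) fun s _ => ?_
    · have h1 := (blocking_le (m := I.localMass s j) hc).trans (I.localMass_mem s j).2
      have h2 := (I.blockRate_nonneg j s).trans (I.blockRate_le_blocking hL j s)
      exact sub_nonneg.2 (mul_le_one₀ hy.2 h2 h1)
    · exact sub_le_sub_left (mul_le_mul_of_nonneg_left (I.blockRate_le_blocking hL j s) hy.1) 1
  have hrate := I.rate_mem j
  have hbound := guarantee_le_concentratedBound hL hx
  calc guarantee L * I.x j ≤ concentratedBound L (I.localMass t j) * I.x j :=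
        mul_le_mul_of_nonneg_right hbound (I.x_nonneg j)
    _ = I.x j * I.rate j * ∫ y in (0 : ℝ)..1, (1 - y * blocking (loss L) 1) ^ (L - 1) *
          (1 - y * blocking (loss L) (1 - I.localMass t j)) := by
        rw [concentratedBound, Input.rate]; ring
    _ ≤ _ := mul_le_mul_of_nonneg_left (hconc.trans hmono)
        (mul_nonneg (I.x_nonneg j) hrate.1)

end RandomElement

end

theorem mainTheorem6 (L : ℕ) (hL : 2 ≤ L) :
    1 / (1 + (L : ℝ)) < RandomElement.guarantee L ∧
      (L = 2 → 0.397 ≤ RandomElement.guarantee L ∧ RandomElement.guarantee L < 0.398) ∧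
      RandomElement.IsSelectable.{u, v} (RandomElement.guarantee L)
        (RandomElement.attenuateGreedy.{u, v} L) := by
  refine ⟨RandomElement.one_div_lt_guarantee hL, ?_,
    RandomElement.isSelectable_attenuateGreedy hL⟩
  rintro rfl
  exact RandomElement.guarantee_two_bounds
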